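/- Let $M$ be a Hausdorff, second countable manifold of class $C^2$ (without boundary), and let $g$ be a semi-Riemannian metric on $M$ (symmetric, nondegenerate, of constant index) whose components in each chart of the given atlas of $M$ are differentiable with locally Lipschitz differential. Geodesics, the exponential maps $\exp_q$, and the Hessian $H_\phi=\nabla(d\phi)$ of a $C^2$ function $\phi$ are those of the Levi-Civita connection $\nabla$ of $g$; in coordinates, $$(H_\phi)_q(u,v)=\frac{\partial^2\phi}{\partial x^i\partial x^j}(q)\,u^iv^j-\frac{\partial\phi}{\partial x^l}(q)\,\Gamma^l_{ij}(q)\,u^iv^j .$$ Let $H\subset M$ be an embedded $C^2$ hypersurface; the bilinear form that $g$ induces on $TH$ may be degenerate. Let $p\in H$ and let $U$ be an open neighborhood of $p$ in $H$. $H$ is called infinitesimally convex in $U$ if there are an open set $\tilde U\subset M$ and a $C^2$ function $\phi\colon\tilde U\to\mathbb R$ such that $U=\tilde U\cap H=\phi^{-1}(0)$, $0$ is a regular value of $\phi$, and either $(H_\phi)_q(v,v)\le 0$ for all $q\in U$ and $v\in T_qH$, or $(H_\phi)_q(v,v)\ge 0$ for all $q\in U$ and $v\in T_qH$. $H$ is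 called locally convex in $U$ if there are an open set $\tilde U\subset M$ with $\tilde U\cap H=U$ and disjoint open sets $A$, $B$ (the two sides of $H$ in $\tilde U$) with $A\cup B=\tilde U\setminus H$ and $U\subset\overline A\cap\overline B$, which are required to be connected, and so to be the two connected components of $\tilde U\setminus H$, whenever $U$ is connected, such that for every $q\in U$ there is a neighborhood $O$ of $0$ in $T_qM$ for which $\exp_q$ is defined on $O\cap T_qH$ and $\exp_q(O\cap T_qH)\subset\overline A$ (the same side $A$ for all $q\in U$). Then $H$ is infinitesimally convex in $U$ if and only if $H$ is locally convex in $U$. -/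

import Mathlib

set_option maxSynthPendingDepth 3

open Set Topology
open scoped Manifold ContDiff

noncomputable section

namespace SemiRiem

variable {E : Type*} [NormedAddCommGroup E] [NormedSpace ℝ E]
  {M : Type*} [TopologicalSpace M] [ChartedSpace E M]

/-- A field of bilinear forms on the tangent spaces of `M`, read in the chart `e`:
`localForm g e y u v = g (D(e⁻¹)_y u, D(e⁻¹)_y v)`, taken at the point `e⁻¹ y`.
Its entries on a basis of `E` are the functions `g_ij` of the chart. -/
def localForm (g : ∀ x : M, TangentSpace 𝓘(ℝ, E) x →L[ℝ] TangentSpace 𝓘(ℝ, E) x →L[ℝ] ℝ)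
    (e : OpenPartialHomeomorph M E) (y : E) : E →L[ℝ] E →L[ℝ] ℝ :=
  let G : E →L[ℝ] E →L[ℝ] ℝ := g (e.symm y)
  let D : E →L[ℝ] E := mfderiv 𝓘(ℝ, E) 𝓘(ℝ, E) e.symm y
  G.bilinearComp D D

variable (E M) in
/-- A semi-Riemannian metric whose differential is locally Lipschitz: a symmetric nondegenerate
bilinear form of constant index on every tangent space, whose components in every chart of the
atlas of `M` are differentiable with locally Lipschitz differential. (The manifold is only assumed
to be of class `C²`, so the regularity is imposed in the charts of the given atlas and not in all
`C²`-compatible charts. On a manifold with a smooth atlas this is the usual notion.) -/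
structure Metric where
  /-- the bilinear form on the tangent space at `x` -/
  form : ∀ x : M, TangentSpace 𝓘(ℝ, E) x →L[ℝ] TangentSpace 𝓘(ℝ, E) x →L[ℝ] ℝ
  symm : ∀ (x : M) (v w : TangentSpace 𝓘(ℝ, E) x), form x v w = form x w v
  nondegenerate : ∀ (x : M) (v : TangentSpace 𝓘(ℝ, E) x), (∀ w, form x v w = 0) → v = 0
  /-- the largest dimension of a negative definite subspace is the same at all points -/
  constant_index : ∃ ν : ℕ, ∀ x : M,
    IsGreatest {k : ℕ | ∃ W : Submodule ℝ (TangentSpace 𝓘(ℝ, E) x),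
      Module.finrank ℝ W = k ∧ ∀ w ∈ W, w ≠ 0 → form x w w < 0} ν
  differentiable : ∀ e ∈ atlas E M, DifferentiableOn ℝ (localForm form e) e.target
  lipschitz : ∀ e ∈ atlas E M, LocallyLipschitzOn e.target (fderiv ℝ (localForm form e))

/-- The Christoffel symbols of the Levi-Civita connection of `g` in the chart `e`, as a vector
valued map: `christoffel g e y u v = Γ^l_ij(y) u^i v^j ∂_l`. With `G = localForm g.form e` it is the
vector `z` determined by `2 G_y(z, w) = (D_u G)_y(v, w) + (D_v G)_y(u, w) - (D_w G)_y(u, v)`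
for all `w`. -/
def christoffel (g : Metric E M) (e : OpenPartialHomeomorph M E) (y u v : E) : E :=
  let G : E → E →L[ℝ] E →L[ℝ] ℝ := localForm g.form e
  let dG : E →L[ℝ] E →L[ℝ] E →L[ℝ] ℝ := fderiv ℝ G y
  ContinuousLinearMap.inverse (G y) ((1 / 2 : ℝ) • (dG u v + dG v u - (dG.flip u).flip v))

/-- The coordinates of a tangent vector at `q` in the preferred chart at `q`. -/
def coord (q : M) (v : TangentSpace 𝓘(ℝ, E) q) : E :=
  mfderiv 𝓘(ℝ, E) 𝓘(ℝ, E) (chartAt E q) q v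

/-- The Hessian `∇(dφ)` at `q`, evaluated on `u, v`:
`∂²φ/∂x^i∂x^j u^i v^j - ∂φ/∂x^l Γ^l_ij u^i v^j`, in the preferred chart at `q`. -/
def hessian (g : Metric E M) (φ : M → ℝ) (q : M) (u v : TangentSpace 𝓘(ℝ, E) q) : ℝ :=
  let e : OpenPartialHomeomorph M E := chartAt E q
  let f : E → ℝ := φ ∘ e.symm
  fderiv ℝ (fderiv ℝ f) (e q) (coord q u) (coord q v)
    - fderiv ℝ f (e q) (christoffel g e (e q) (coord q u) (coord q v))

/-- The curve `c`, restricted to `s`, passes through `q` at the time `t` with velocity `v`. -/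
def HasVelocityWithin (c : ℝ → M) (s : Set ℝ) (t : ℝ) (q : M) (v : TangentSpace 𝓘(ℝ, E) q) :
    Prop :=
  c t = q ∧ ContinuousWithinAt c s t ∧ HasDerivWithinAt (chartAt E q ∘ c) (coord q v) s t

/-- `γ` is an (affinely parametrized) geodesic on the set of times `s` (an interval): it is
continuous on `s`, and in every chart of the atlas it is twice differentiable and satisfies
`γ'' + Γ(γ', γ') = 0`; the function `w` is the derivative of `γ` in the chart. -/
def IsGeodesicOn (g : Metric E M) (γ : ℝ → M) (s : Set ℝ) : Prop :=
  ContinuousOn γ s ∧ ∀ e ∈ atlas E M, ∃ w : ℝ → E, ∀ t ∈ s, γ t ∈ e.source →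
    HasDerivWithinAt (e ∘ γ) (w t) s t ∧
    HasDerivWithinAt w (-christoffel g e (e (γ t)) (w t) (w t)) s t

/-- `exp_q v` is defined and equal to `x`: there is a geodesic on `[0, 1]` that starts at `q` with
velocity `v` and ends at `x`. -/
def IsExp (g : Metric E M) (q : M) (v : TangentSpace 𝓘(ℝ, E) q) (x : M) : Prop :=
  ∃ γ : ℝ → M, IsGeodesicOn g γ (Icc 0 1) ∧ HasVelocityWithin γ (Icc 0 1) 0 q v ∧ γ 1 = x

variable (E) in
/-- `H` is an embedded `C²` hypersurface: around each of its points there is a chart of class `C²`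
of `M` that maps `H` onto (a piece of) a hyperplane of `E`. -/
def IsHypersurface (H : Set M) : Prop :=
  ∀ q ∈ H, ∃ e ∈ IsManifold.maximalAtlas 𝓘(ℝ, E) 2 M, q ∈ e.source ∧
    ∃ ℓ : E →L[ℝ] ℝ, ℓ ≠ 0 ∧ ∀ x ∈ e.source, x ∈ H ↔ ℓ (e x) = 0

/-- The tangent space `T_q H`: velocities at `q` of curves in `H`. -/
def tangentSet (H : Set M) (q : M) : Set (TangentSpace 𝓘(ℝ, E) q) :=
  {v | ∃ c : ℝ → M, (∀ t, c t ∈ H) ∧ HasVelocityWithin c univ 0 q v}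

/-- `H` is infinitesimally convex in its subset `U`: there are an open set `V` of `M` and a `C²`
function `φ` on `V` with `U = V ∩ H = φ⁻¹(0)`, for which `0` is a regular value and whose Hessian
is negative semidefinite on all tangent spaces of `H` at points of `U`, or positive semidefinite on
all of them. -/
def InfinitesimallyConvexIn (g : Metric E M) (H U : Set M) : Prop :=
  ∃ (V : Set M) (φ : M → ℝ), IsOpen V ∧ ContMDiffOn 𝓘(ℝ, E) 𝓘(ℝ, ℝ) 2 φ V ∧
    V ∩ H = U ∧ {x ∈ V | φ x = 0} = U ∧
    (∀ x ∈ U, mfderiv 𝓘(ℝ, E) 𝓘(ℝ, ℝ) φ x ≠ 0) ∧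
    ((∀ q ∈ U, ∀ v ∈ tangentSet (E := E) H q, hessian g φ q v v ≤ 0) ∨
     (∀ q ∈ U, ∀ v ∈ tangentSet (E := E) H q, 0 ≤ hessian g φ q v v))

/-- `A` and `B` are the two sides of `H` in the open set `V`: disjoint open sets with union
`V \ H`, both of which have all of `V ∩ H` in their closure. If `V ∩ H` is connected, `A` and `B`
are moreover required to be connected, so that they are the two connected components of `V \ H`.
(If `V ∩ H` is not connected, then `V \ H` may need to have more than two components, and each
side is a union of components.) -/
def AreSides (H V A B : Set M) : Prop :=
  IsOpen A ∧ IsOpen B ∧ Disjoint A B ∧ A ∪ B = V \ H ∧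
    V ∩ H ⊆ closure A ∧ V ∩ H ⊆ closure B ∧
    (IsConnected (V ∩ H) → IsConnected A ∧ IsConnected B)

/-- `H` is locally convex in its subset `U`: there is an open set `V` of `M` with `V ∩ H = U` such
that the closure of one of the two sides `A` of `H` in `V` contains, for each `q` in `U`, the points
`exp_q v` for all `v ∈ T_q H` in a neighborhood of `0` (on which `exp_q` is defined). -/
def LocallyConvexIn (g : Metric E M) (H U : Set M) : Prop :=
  ∃ V A B : Set M, IsOpen V ∧ V ∩ H = U ∧ AreSides H V A B ∧
    ∀ q ∈ U, ∃ O ∈ 𝓝 (0 : TangentSpace 𝓘(ℝ, E) q), ∀ v ∈ O, v ∈ tangentSet (E := E) H q →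
      ∃ x ∈ closure A, IsExp g q v x

end SemiRiem

end

/-! Everything rests on second derivatives along geodesics: if `φ` is `C²` and `γ` is a geodesic,
then `(φ ∘ γ)'' = H_φ(γ', γ')`.

Local to infinitesimal. A geodesic `γ` starting at `q` tangentially to `H` stays in the closure of
`A` for a short time. If `φ` vanishes on `H` and is positive on `A`, then `φ ∘ γ` is nonnegative to
the right of `0` and vanishes there to first order, so its second derivative at `0` is nonnegative
(`hessian_nonneg_of_isExp`). The points `exp_q (t v)` given by the hypothesis lie on a single curve
by uniqueness of geodesics (`IsChartSolution.eq_of_isGeodesicOn`). A defining function on a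
neighborhood of all of `U` is glued from local ones that are positive on `A` and negative on `B`.
Weighted sums keep these signs, and a domination argument keeps the differential nonzero
(`mfderiv_ne_zero_of_le`).

Infinitesimal to local. The sign of the Hessian is known only at points of `H` and on vectors
tangent to `H`, while the geodesic may leave `H`. In a chart, `H` is a graph in some direction `n`.
Let `ψ` be the height over it (`exists_height`). To a point `x` with velocity `w` correspond the
foot point `y = x - ψ(x) n` on `H` and the tangential velocity `u = w - dψ(w) n`. Although `ψ` is
merely `C²`, its second derivatives at `(x, w)` and `(y, u)` agree exactly, since `ψ` is affine with
slope one along `n`. The two chart Hessians therefore differ only through the Christoffel symbols,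
which are locally Lipschitz because `g` has locally Lipschitz differential, and the difference is at
most `C (|ψ| + |dψ(w)|)`. Hence `f = ψ ∘ γ` satisfies `f'' ≥ -C (|f| + |f'|)` with `f(0) = f'(0) =
0`, and the comparison principle `nonneg_of_second_deriv_ge` gives `f ≥ 0` for a short time. This is
`exists_nhds_forall_nonneg`. The time is uniform over small initial velocities, so rescaling covers
a full neighborhood of `0` in `T_q H`.

The connectedness required of the two sides is obtained by shrinking the open set to a union of
chart balls centered on `U`, in which each side is a half ball (`exists_side_nhds`,
`isPreconnected_biUnion_inter`). -/

noncomputable section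

namespace SemiRiem

/-! ### Transition maps -/

section Transition

variable {E : Type*} [NormedAddCommGroup E] {M : Type*} [TopologicalSpace M]

lemma eventually_transition {e e' : OpenPartialHomeomorph M E}
    {y : E} (hy : y ∈ e.target) (hy' : e.symm y ∈ e'.source) :
    ∀ᶠ z in 𝓝 y, z ∈ e.target ∧ e.symm z ∈ e'.source :=
  Filter.inter_mem (e.open_target.mem_nhds hy)
    ((e.continuousAt_symm hy).preimage_mem_nhds (e'.open_source.mem_nhds hy'))

lemma comp_symm_eventuallyEq {e e' : OpenPartialHomeomorph M E} {y : E} (hy : y ∈ e.target)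
    (hy' : e.symm y ∈ e'.source) (φ : M → ℝ) :
    φ ∘ e.symm =ᶠ[𝓝 y] (φ ∘ e'.symm) ∘ (e' ∘ e.symm) := by
  filter_upwards [eventually_transition hy hy'] with z hz
  simp [e'.left_inv hz.2]

end Transition

/-! ### The metric in charts -/

section Charts

variable {E : Type*} [NormedAddCommGroup E] [NormedSpace ℝ E]
  {M : Type*} [TopologicalSpace M] [ChartedSpace E M]

lemma mfderiv_chartAt_self [IsManifold 𝓘(ℝ, E) 1 M] (q : M) :
    mfderiv 𝓘(ℝ, E) 𝓘(ℝ, E) (chartAt E q) q = ContinuousLinearMap.id ℝ E := by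
  have := mfderiv_extChartAt_self (I := 𝓘(ℝ, E)) (x := q)
  simpa using! this

lemma coord_eq [IsManifold 𝓘(ℝ, E) 1 M] (q : M) (v : TangentSpace 𝓘(ℝ, E) q) :
    coord q v = v := by
  rw [coord, mfderiv_chartAt_self]; rfl

lemma contDiffAt_transition [IsManifold 𝓘(ℝ, E) 2 M] {e e' : OpenPartialHomeomorph M E}
    (he : e ∈ IsManifold.maximalAtlas 𝓘(ℝ, E) 2 M) (he' : e' ∈ IsManifold.maximalAtlas 𝓘(ℝ, E) 2 M)
    {y : E} (hy : y ∈ e.target) (hy' : e.symm y ∈ e'.source) :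
    ContDiffAt ℝ 2 (e' ∘ e.symm) y := by
  rw [← contMDiffAt_iff_contDiffAt]
  exact (contMDiffAt_of_mem_maximalAtlas he' hy').comp y (contMDiffAt_symm_of_mem_maximalAtlas he hy)

lemma mfderiv_symm_transition [IsManifold 𝓘(ℝ, E) 2 M] {e e' : OpenPartialHomeomorph M E}
    (he : e ∈ atlas E M) (he' : e' ∈ atlas E M)
    {y : E} (hy : y ∈ e.target) (hy' : e.symm y ∈ e'.source) (u : E) :
    (mfderiv 𝓘(ℝ, E) 𝓘(ℝ, E) e.symm y : E →L[ℝ] E) u =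
      (mfderiv 𝓘(ℝ, E) 𝓘(ℝ, E) e'.symm ((e' ∘ e.symm) y) : E →L[ℝ] E)
        (fderiv ℝ (e' ∘ e.symm) y u) := by
  have h1 : e.symm =ᶠ[𝓝 y] e'.symm ∘ (e' ∘ e.symm) := by
    filter_upwards [eventually_transition hy hy'] with z hz
    simp [e'.left_inv hz.2]
  have hd : MDifferentiableAt 𝓘(ℝ, E) 𝓘(ℝ, E) (e' ∘ e.symm) y :=
    ((contDiffAt_transition (IsManifold.subset_maximalAtlas he)
      (IsManifold.subset_maximalAtlas he') hy hy').differentiableAt two_ne_zero).mdifferentiableAt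
  have hs : MDifferentiableAt 𝓘(ℝ, E) 𝓘(ℝ, E) e'.symm ((e' ∘ e.symm) y) :=
    mdifferentiableAt_atlas_symm he' (e'.map_source hy')
  have h2 := mfderiv_comp y hs hd
  rw [← mfderiv_eq_fderiv]
  have h3 := h1.mfderiv_eq (I := 𝓘(ℝ, E)) (I' := 𝓘(ℝ, E))
  exact (congrArg (fun L : E →L[ℝ] E => L u) h3).trans (congrArg (fun L : E →L[ℝ] E => L u) h2)

lemma mfderiv_symm_bijective [IsManifold 𝓘(ℝ, E) 2 M] {e : OpenPartialHomeomorph M E}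
    (he : e ∈ atlas E M) {y : E} (hy : y ∈ e.target) :
    Function.Bijective (mfderiv 𝓘(ℝ, E) 𝓘(ℝ, E) e.symm y : E →L[ℝ] E) :=
  (mdifferentiable_of_mem_atlas (I := 𝓘(ℝ, E)) he).symm.mfderiv_bijective hy

lemma localForm_apply (g : Metric E M) (e : OpenPartialHomeomorph M E) (y u v : E) :
    localForm g.form e y u v = g.form (e.symm y)
      ((mfderiv 𝓘(ℝ, E) 𝓘(ℝ, E) e.symm y : E →L[ℝ] E) u)
      ((mfderiv 𝓘(ℝ, E) 𝓘(ℝ, E) e.symm y : E →L[ℝ] E) v) := rfl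

lemma localForm_symm (g : Metric E M) (e : OpenPartialHomeomorph M E) (y u v : E) :
    localForm g.form e y u v = localForm g.form e y v u := by
  rw [localForm_apply, localForm_apply, g.symm]

lemma localForm_transition [IsManifold 𝓘(ℝ, E) 2 M] (g : Metric E M)
    {e e' : OpenPartialHomeomorph M E} (he : e ∈ atlas E M) (he' : e' ∈ atlas E M)
    {y : E} (hy : y ∈ e.target) (hy' : e.symm y ∈ e'.source) (u v : E) :
    localForm g.form e y u v = localForm g.form e' ((e' ∘ e.symm) y)
      (fderiv ℝ (e' ∘ e.symm) y u) (fderiv ℝ (e' ∘ e.symm) y v) := by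
  rw [localForm_apply, localForm_apply, mfderiv_symm_transition he he' hy hy' u,
    mfderiv_symm_transition he he' hy hy' v]
  have : ∀ (x x' : M), x = x' → ∀ a b : E, (g.form x : E →L[ℝ] E →L[ℝ] ℝ) a b =
      (g.form x' : E →L[ℝ] E →L[ℝ] ℝ) a b := by
    rintro x _ rfl a b; rfl
  exact this _ _ (e'.left_inv hy').symm _ _

lemma localForm_nondegenerate [IsManifold 𝓘(ℝ, E) 2 M] (g : Metric E M)
    {e : OpenPartialHomeomorph M E} (he : e ∈ atlas E M) {y : E} (hy : y ∈ e.target) {u : E}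
    (hu : ∀ v, localForm g.form e y u v = 0) : u = 0 := by
  have hb := mfderiv_symm_bijective he hy
  have h0 : (mfderiv 𝓘(ℝ, E) 𝓘(ℝ, E) e.symm y : E →L[ℝ] E) 0 = 0 := map_zero _
  refine hb.1 (Eq.trans ?_ h0.symm)
  apply g.nondegenerate
  intro w
  obtain ⟨v, rfl⟩ := hb.2 w
  exact hu v

lemma exists_equiv_localForm [IsManifold 𝓘(ℝ, E) 2 M] [FiniteDimensional ℝ E] (g : Metric E M)
    {e : OpenPartialHomeomorph M E} (he : e ∈ atlas E M) {y : E} (hy : y ∈ e.target) :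
    ∃ L : E ≃L[ℝ] (E →L[ℝ] ℝ), (L : E →L[ℝ] E →L[ℝ] ℝ) = localForm g.form e y := by
  have hinj : Function.Injective (localForm g.form e y).toLinearMap := by
    rw [injective_iff_map_eq_zero]
    intro u hu
    exact localForm_nondegenerate g he hy fun v => by
      have := congrArg (fun L : E →L[ℝ] ℝ => L v) hu
      simpa using this
  have hfin : Module.finrank ℝ E = Module.finrank ℝ (E →L[ℝ] ℝ) := by
    rw [← (LinearMap.toContinuousLinearMap (𝕜 := ℝ) (E := E) (F' := ℝ)).finrank_eq]
    exact (Subspace.dual_finrank_eq).symm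
  refine ⟨(LinearEquiv.ofInjectiveOfFinrankEq _ hinj hfin).toContinuousLinearEquiv, ?_⟩
  ext u v
  rfl

end Charts

/-! ### Christoffel symbols: transformation law and Lipschitz regularity -/

section Christoffel

variable {E : Type*} [NormedAddCommGroup E] [NormedSpace ℝ E]
  {M : Type*} [TopologicalSpace M] [ChartedSpace E M]

/-- Nondegeneracy makes `ContinuousLinearMap.inverse` a genuine inverse here rather than its default
value `0`, so the Koszul formula may be used as the characterization of the symbols. -/
lemma localForm_christoffel [IsManifold 𝓘(ℝ, E) 2 M] [FiniteDimensional ℝ E] (g : Metric E M)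
    {e : OpenPartialHomeomorph M E} (he : e ∈ atlas E M) {y : E} (hy : y ∈ e.target) (u v w : E) :
    localForm g.form e y (christoffel g e y u v) w =
      (1 / 2 : ℝ) * (fderiv ℝ (localForm g.form e) y u v w + fderiv ℝ (localForm g.form e) y v u w
        - fderiv ℝ (localForm g.form e) y w u v) := by
  obtain ⟨L, hL⟩ := exists_equiv_localForm g he hy
  simp only [christoffel]
  rw [← hL, ContinuousLinearMap.inverse_equiv]
  simp

/-- A locally Lipschitz differential is in particular continuous. -/
lemma contDiffAt_localForm (g : Metric E M) {e : OpenPartialHomeomorph M E} (he : e ∈ atlas E M)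
    {y : E} (hy : y ∈ e.target) : ContDiffAt ℝ 1 (localForm g.form e) y := by
  rw [contDiffAt_one_iff]
  refine ⟨fderiv ℝ (localForm g.form e), e.target, e.open_target.mem_nhds hy,
    (g.lipschitz e he).continuousOn, fun z hz =>
      ((g.differentiable e he z hz).differentiableAt (e.open_target.mem_nhds hz)).hasFDerivAt⟩

/-- The second derivative of a composition. -/
lemma fderiv_fderiv_comp {F G : Type*} [NormedAddCommGroup F] [NormedSpace ℝ F]
    [NormedAddCommGroup G] [NormedSpace ℝ G] {f : F → G} {τ : E → F} {y : E}
    (hf : ContDiffAt ℝ 2 f (τ y)) (hτ : ContDiffAt ℝ 2 τ y) (u v : E) :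
    fderiv ℝ (fderiv ℝ (f ∘ τ)) y u v =
      fderiv ℝ (fderiv ℝ f) (τ y) (fderiv ℝ τ y u) (fderiv ℝ τ y v) +
        fderiv ℝ f (τ y) (fderiv ℝ (fderiv ℝ τ) y u v) := by
  have h1 : ∀ᶠ z in 𝓝 y, ContDiffAt ℝ 2 τ z := hτ.eventually (by simp)
  have h2 : ∀ᶠ z in 𝓝 y, ContDiffAt ℝ 2 f (τ z) :=
    hτ.continuousAt.eventually (hf.eventually (by simp))
  have h3 : fderiv ℝ (f ∘ τ) =ᶠ[𝓝 y] fun z => (fderiv ℝ f (τ z)).comp (fderiv ℝ τ z) := by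
    filter_upwards [h1, h2] with z hz hz'
    exact fderiv_comp z (hz'.differentiableAt two_ne_zero) (hz.differentiableAt two_ne_zero)
  have hf1 : DifferentiableAt ℝ (fderiv ℝ f) (τ y) :=
    (hf.fderiv_right (m := 1) (by norm_num)).differentiableAt one_ne_zero
  have hτ1 : DifferentiableAt ℝ (fderiv ℝ τ) y :=
    (hτ.fderiv_right (m := 1) (by norm_num)).differentiableAt one_ne_zero
  have hc : HasFDerivAt (fun z => fderiv ℝ f (τ z))
      ((fderiv ℝ (fderiv ℝ f) (τ y)).comp (fderiv ℝ τ y)) y :=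
    hf1.hasFDerivAt.comp y (hτ.differentiableAt two_ne_zero).hasFDerivAt
  have h4 := hc.clm_comp hτ1.hasFDerivAt
  rw [h3.fderiv_eq, h4.fderiv]
  simp [add_comm]

/-- This is the product rule applied to `localForm_transition`; the terms with second derivatives of
the transition map produce the inhomogeneous term in the law for the Christoffel symbols. -/
lemma fderiv_localForm_transition [IsManifold 𝓘(ℝ, E) 2 M] (g : Metric E M)
    {e e' : OpenPartialHomeomorph M E} (he : e ∈ atlas E M) (he' : e' ∈ atlas E M)
    {y : E} (hy : y ∈ e.target) (hy' : e.symm y ∈ e'.source) (w u v : E) :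
    fderiv ℝ (localForm g.form e) y w u v =
      fderiv ℝ (localForm g.form e') ((e' ∘ e.symm) y) (fderiv ℝ (e' ∘ e.symm) y w)
        (fderiv ℝ (e' ∘ e.symm) y u) (fderiv ℝ (e' ∘ e.symm) y v) +
      localForm g.form e' ((e' ∘ e.symm) y) (fderiv ℝ (fderiv ℝ (e' ∘ e.symm)) y w u)
        (fderiv ℝ (e' ∘ e.symm) y v) +
      localForm g.form e' ((e' ∘ e.symm) y) (fderiv ℝ (e' ∘ e.symm) y u)
        (fderiv ℝ (fderiv ℝ (e' ∘ e.symm)) y w v) := by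
  set τ := e' ∘ e.symm with hτdef
  have hτ : ContDiffAt ℝ 2 τ y := contDiffAt_transition (IsManifold.subset_maximalAtlas he)
      (IsManifold.subset_maximalAtlas he') hy hy'
  have hd := (g.differentiable e he y hy).differentiableAt (e.open_target.mem_nhds hy)
  have hy2 : τ y ∈ e'.target := e'.map_source hy'
  have hd' := (g.differentiable e' he' _ hy2).differentiableAt (e'.open_target.mem_nhds hy2)
  have hτ1 : DifferentiableAt ℝ (fderiv ℝ τ) y :=
    (hτ.fderiv_right (m := 1) (by norm_num)).differentiableAt one_ne_zero
  have h1 := (hd.hasFDerivAt.clm_apply (hasFDerivAt_const u y)).clm_apply (hasFDerivAt_const v y)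
  have hu := hτ1.hasFDerivAt.clm_apply (hasFDerivAt_const u y)
  have hv := hτ1.hasFDerivAt.clm_apply (hasFDerivAt_const v y)
  have hG : HasFDerivAt (fun z => localForm g.form e' (τ z)) _ y :=
    hd'.hasFDerivAt.comp y (hτ.differentiableAt two_ne_zero).hasFDerivAt
  have h2 := (hG.clm_apply hu).clm_apply hv
  have h3 : (fun z => localForm g.form e z u v) =ᶠ[𝓝 y]
      fun z => localForm g.form e' (τ z) (fderiv ℝ τ z u) (fderiv ℝ τ z v) := by
    filter_upwards [eventually_transition hy hy'] with z hz
    exact localForm_transition g he he' hz.1 hz.2 u v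
  have h4 := congrArg (fun L : E →L[ℝ] ℝ => L w) (h1.unique (h2.congr_of_eventuallyEq h3))
  simp at h4
  rw [h4]; ring

lemma fderiv_fderiv_symm {F : Type*} [NormedAddCommGroup F] [NormedSpace ℝ F] {f : E → F} {y : E}
    (hf : ContDiffAt ℝ 2 f y) (u v : E) :
    fderiv ℝ (fderiv ℝ f) y u v = fderiv ℝ (fderiv ℝ f) y v u :=
  (hf.isSymmSndFDerivAt (by simp)).eq u v

lemma fderiv_transition_surjective [IsManifold 𝓘(ℝ, E) 2 M]
    {e e' : OpenPartialHomeomorph M E} (he : e ∈ atlas E M) (he' : e' ∈ atlas E M)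
    {y : E} (hy : y ∈ e.target) (hy' : e.symm y ∈ e'.source) :
    Function.Surjective (fderiv ℝ (e' ∘ e.symm) y) := by
  intro w
  obtain ⟨u, hu⟩ := (mfderiv_symm_bijective he hy).2
    ((mfderiv 𝓘(ℝ, E) 𝓘(ℝ, E) e'.symm ((e' ∘ e.symm) y) : E →L[ℝ] E) w)
  refine ⟨u, ?_⟩
  rw [mfderiv_symm_transition he he' hy hy' u] at hu
  exact (mfderiv_symm_bijective he' (e'.map_source hy')).1 hu

/-- The transformation law of the Christoffel symbols. -/
lemma christoffel_transition [IsManifold 𝓘(ℝ, E) 2 M] [FiniteDimensional ℝ E] (g : Metric E M)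
    {e e' : OpenPartialHomeomorph M E} (he : e ∈ atlas E M) (he' : e' ∈ atlas E M)
    {y : E} (hy : y ∈ e.target) (hy' : e.symm y ∈ e'.source) (u v : E) :
    fderiv ℝ (e' ∘ e.symm) y (christoffel g e y u v) =
      christoffel g e' ((e' ∘ e.symm) y) (fderiv ℝ (e' ∘ e.symm) y u)
        (fderiv ℝ (e' ∘ e.symm) y v) + fderiv ℝ (fderiv ℝ (e' ∘ e.symm)) y u v := by
  have hy2 : (e' ∘ e.symm) y ∈ e'.target := e'.map_source hy'
  have hτ := contDiffAt_transition (IsManifold.subset_maximalAtlas (I := 𝓘(ℝ, E)) (n := 2) he)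
      (IsManifold.subset_maximalAtlas he') hy hy'
  -- By nondegeneracy it suffices to pair the difference of the two sides with all vectors, and
  -- these are all images of some `w` under the differential of the transition map.
  rw [← sub_eq_zero]
  apply localForm_nondegenerate g he' hy2
  intro w'
  obtain ⟨w, rfl⟩ := fderiv_transition_surjective he he' hy hy' w'
  have h1 := localForm_christoffel g he hy u v w
  rw [localForm_transition g he he' hy hy', fderiv_localForm_transition g he he' hy hy',
    fderiv_localForm_transition g he he' hy hy', fderiv_localForm_transition g he he' hy hy'] at h1
  have h2 := localForm_christoffel g he' hy2 (fderiv ℝ (e' ∘ e.symm) y u)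
    (fderiv ℝ (e' ∘ e.symm) y v) (fderiv ℝ (e' ∘ e.symm) y w)
  simp only [map_sub, map_add, sub_apply, add_apply]
  -- Of the six terms with a second derivative of the transition map `τ`, four cancel in pairs by
  -- symmetry; the other two both equal the form at `τ''(u, v)` and `τ' w`, which absorbs the factor
  -- `1 / 2`.
  rw [h1, h2, fderiv_fderiv_symm hτ v u, fderiv_fderiv_symm hτ w u, fderiv_fderiv_symm hτ w v,
    localForm_symm g e' _ (fderiv ℝ (e' ∘ e.symm) y v) (fderiv ℝ (fderiv ℝ (e' ∘ e.symm)) y u w),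
    localForm_symm g e' _ (fderiv ℝ (e' ∘ e.symm) y u) (fderiv ℝ (fderiv ℝ (e' ∘ e.symm)) y v w)]
  ring

/-- The geodesic spray is locally Lipschitz. -/
lemma exists_lipschitzOnWith_christoffel [IsManifold 𝓘(ℝ, E) 2 M] [FiniteDimensional ℝ E]
    (g : Metric E M) {e : OpenPartialHomeomorph M E} (he : e ∈ atlas E M) {y : E}
    (hy : y ∈ e.target) (w : E) :
    ∃ K, ∃ t ∈ 𝓝 (y, w), LipschitzOnWith K (fun p : E × E => christoffel g e p.1 p.2 p.2) t := by
  have : CompleteSpace E := FiniteDimensional.complete ℝ E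
  -- The symbols are a `C¹` function `Φ` of the inverse of the metric, its differential and the
  -- velocity. The second of these is only Lipschitz in the base point, so the composition is
  -- Lipschitz.
  let Φ : ((E →L[ℝ] ℝ) →L[ℝ] E) × (E →L[ℝ] E →L[ℝ] E →L[ℝ] ℝ) × E → E := fun p =>
    p.1 ((1 / 2 : ℝ) • (p.2.1 p.2.2 p.2.2 + p.2.1 p.2.2 p.2.2 - (p.2.1.flip p.2.2).flip p.2.2))
  have hΦ : ContDiff ℝ 1 Φ := by
    have hfl : ContDiff ℝ 1 (fun p : ((E →L[ℝ] ℝ) →L[ℝ] E) × (E →L[ℝ] E →L[ℝ] E →L[ℝ] ℝ) × E =>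
        p.2.1.flip) :=
      (ContinuousLinearMap.flipₗᵢ ℝ E E (E →L[ℝ] ℝ)).contDiff.comp contDiff_snd.fst
    have hfl2 : ContDiff ℝ 1 (fun p : ((E →L[ℝ] ℝ) →L[ℝ] E) × (E →L[ℝ] E →L[ℝ] E →L[ℝ] ℝ) × E =>
        (p.2.1.flip p.2.2).flip) :=
      (ContinuousLinearMap.flipₗᵢ ℝ E E ℝ).contDiff.comp (hfl.clm_apply contDiff_snd.snd)
    have h2 : ContDiff ℝ 1 (fun p : ((E →L[ℝ] ℝ) →L[ℝ] E) × (E →L[ℝ] E →L[ℝ] E →L[ℝ] ℝ) × E =>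
        p.2.1 p.2.2 p.2.2) := (contDiff_snd.fst.clm_apply contDiff_snd.snd).clm_apply
          contDiff_snd.snd
    exact contDiff_fst.clm_apply
      (((h2.add h2).sub (hfl2.clm_apply contDiff_snd.snd)).const_smul _)
  obtain ⟨L, hL⟩ := exists_equiv_localForm g he hy
  have hinv : ContDiffAt ℝ 1 (fun z => ContinuousLinearMap.inverse (localForm g.form e z)) y := by
    have h1 : ContDiffAt ℝ 1 ContinuousLinearMap.inverse (localForm g.form e y) := by
      rw [← hL]; exact contDiffAt_map_inverse L
    exact h1.comp y (contDiffAt_localForm g he hy)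
  obtain ⟨K₁, t₁, ht₁, hK₁⟩ := hinv.exists_lipschitzOnWith
  obtain ⟨K₂, t₂, ht₂, hK₂⟩ := g.lipschitz e he hy
  rw [e.open_target.nhdsWithin_eq hy] at ht₂
  let Ψ : E × E → ((E →L[ℝ] ℝ) →L[ℝ] E) × (E →L[ℝ] E →L[ℝ] E →L[ℝ] ℝ) × E := fun p =>
    (ContinuousLinearMap.inverse (localForm g.form e p.1), fderiv ℝ (localForm g.form e) p.1, p.2)
  have hΨ : LipschitzOnWith (max (K₁ * 1) (max (K₂ * 1) 1)) Ψ (Prod.fst ⁻¹' (t₁ ∩ t₂)) := by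
    refine LipschitzOnWith.prodMk ?_ (LipschitzOnWith.prodMk ?_ ?_)
    · exact (hK₁.mono inter_subset_left).comp LipschitzWith.prod_fst.lipschitzOnWith (mapsTo_preimage _ _)
    · exact (hK₂.mono inter_subset_right).comp LipschitzWith.prod_fst.lipschitzOnWith (mapsTo_preimage _ _)
    · exact LipschitzWith.prod_snd.lipschitzOnWith
  have hmem : Prod.fst ⁻¹' (t₁ ∩ t₂) ∈ 𝓝 (y, w) :=
    continuousAt_fst.preimage_mem_nhds (Filter.inter_mem ht₁ ht₂)
  have hcont : ContinuousAt Ψ (y, w) := hΨ.continuousOn.continuousAt hmem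
  obtain ⟨K₃, t₃, ht₃, hK₃⟩ := hΦ.contDiffAt.exists_lipschitzOnWith (x := Ψ (y, w))
  refine ⟨K₃ * max (K₁ * 1) (max (K₂ * 1) 1), Prod.fst ⁻¹' (t₁ ∩ t₂) ∩ Ψ ⁻¹' t₃, Filter.inter_mem hmem
    (hcont.preimage_mem_nhds ht₃), ?_⟩
  exact hK₃.comp (hΨ.mono inter_subset_left) (fun p hp => hp.2)

end Christoffel

/-- Local solutions of an autonomous Lipschitz differential equation exist for a uniform (and
arbitrarily short) time and stay in a prescribed neighborhood. -/
lemma exists_solution_mem {X : Type*} [NormedAddCommGroup X] [NormedSpace ℝ X] [CompleteSpace X]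
    {f : X → X} {p₀ : X} {K : NNReal} {t N : Set X} (ht : t ∈ 𝓝 p₀) (hf : LipschitzOnWith K f t)
    (hN : N ∈ 𝓝 p₀) {τ : ℝ} (hτ : 0 < τ) :
    ∃ T, 0 < T ∧ T < τ ∧ ∃ r > 0, ∀ p ∈ Metric.closedBall p₀ r, ∃ α : ℝ → X, α 0 = p ∧
      ∀ s ∈ Icc 0 T, HasDerivWithinAt α (f (α s)) (Icc 0 T) s ∧ α s ∈ N := by
  obtain ⟨a, ha, haN⟩ := Metric.nhds_basis_closedBall.mem_iff.1 (Filter.inter_mem ht hN)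
  obtain ⟨L, hL, hbound⟩ : ∃ L : ℝ, 0 < L ∧ ∀ x ∈ Metric.closedBall p₀ a, ‖f x‖ ≤ L := by
    refine ⟨K * a + ‖f p₀‖ + 1, by positivity, fun x hx => ?_⟩
    have h1 := hf.norm_sub_le (haN hx).1 (mem_of_mem_nhds ht)
    have h2 : ‖x - p₀‖ ≤ a := by simpa [dist_eq_norm] using hx
    have h3 : (K : ℝ) * ‖x - p₀‖ ≤ K * a := by gcongr
    have := norm_le_norm_sub_add (f x) (f p₀)
    linarith
  -- With speed at most `L`, a solution starting within `a / 2` of `p₀` cannot leave the ball of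
  -- radius `a` before time `a / (2 * L)`. Halving `τ` makes `T < τ` strict.
  set T := min (τ / 2) (a / (2 * L)) with hT
  have hT0 : 0 < T := lt_min (by positivity) (by positivity)
  have hTL : L * T ≤ a / 2 := by
    calc L * T ≤ L * (a / (2 * L)) := by gcongr; exact min_le_right _ _
      _ = a / 2 := by field_simp
  refine ⟨T, hT0, (min_le_left _ _).trans_lt (by linarith), a / 2, by positivity, fun p hp => ?_⟩
  lift a to NNReal using ha.le
  lift L to NNReal using hL.le
  have hPL : IsPicardLindelof (fun _ => f) (tmin := 0) (tmax := T) ⟨0, left_mem_Icc.2 hT0.le⟩ p₀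
      a (a / 2) L K := by
    refine IsPicardLindelof.of_time_independent hbound (hf.mono fun x hx => (haN hx).1) ?_
    simp only [NNReal.coe_div, NNReal.coe_ofNat, sub_zero, sub_self, max_eq_left hT0.le]
    linarith
  have hp' : p ∈ Metric.closedBall p₀ ((a / 2 : NNReal) : ℝ) := by simpa using hp
  obtain ⟨α, hα⟩ := ODE.FunSpace.exists_isFixedPt_next hPL hp'
  have hmem : ∀ s, α.compProj s ∈ Metric.closedBall p₀ a := fun s =>
    α.compProj_mem_closedBall hPL.mul_max_le
  refine ⟨α.compProj, ?_, fun s hs => ⟨?_, (haN (hmem s)).2⟩⟩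
  · have := ODE.FunSpace.compProj_val (α := α) (t := ⟨0, left_mem_Icc.2 hT0.le⟩)
    rw [this, ← hα, ODE.FunSpace.next_apply₀]
  · refine (ODE.hasDerivWithinAt_picard_Icc (t₀ := 0) (left_mem_Icc.2 hT0.le)
      hPL.continuousOn_uncurry α.continuous_compProj.continuousOn (fun _ _ => hmem _) p hs).congr_of_mem
      (fun s' hs' => ?_) hs
    rw [ODE.FunSpace.compProj_of_mem hs', ← hα]
    rw [ODE.FunSpace.next_apply, hα]

/-! ### Geodesics in charts: existence, rescaling, uniqueness -/

section Geodesic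

variable {E : Type*} [NormedAddCommGroup E] [NormedSpace ℝ E]
  {M : Type*} [TopologicalSpace M] [ChartedSpace E M]

/-- `x` solves the geodesic equation in the chart `e`, with derivative `w`. -/
def IsChartSolution (g : Metric E M) (e : OpenPartialHomeomorph M E) (x w : ℝ → E)
    (s : Set ℝ) : Prop :=
  ∀ t ∈ s, x t ∈ e.target ∧ HasDerivWithinAt x (w t) s t ∧
    HasDerivWithinAt w (-christoffel g e (x t) (w t) (w t)) s t

lemma christoffel_smul (g : Metric E M) (e : OpenPartialHomeomorph M E) (y u : E) (c : ℝ) :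
    christoffel g e y (c • u) (c • u) = (c * c) • christoffel g e y u u := by
  have h (A : E →L[ℝ] E →L[ℝ] E →L[ℝ] ℝ) :
      A (c • u) (c • u) + A (c • u) (c • u) - (A.flip (c • u)).flip (c • u) =
        (c * c) • (A u u + A u u - (A.flip u).flip u) := by
    ext z
    simp
    ring
  simp only [christoffel]
  rw [h, smul_comm, map_smul]

/-- The equation is homogeneous of degree two in the velocity, so time can be traded for speed. This
turns a solution on a short interval into one on `[0, 1]`, the interval used by `IsExp`. -/
lemma IsChartSolution.rescale {g : Metric E M} {e : OpenPartialHomeomorph M E} {x w : ℝ → E}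
    {b : ℝ} (h : IsChartSolution g e x w (Icc 0 b)) {c : ℝ} (hc : 0 ≤ c) (hcb : c ≤ b) :
    IsChartSolution g e (fun t => x (c * t)) (fun t => c • w (c * t)) (Icc 0 1) := by
  have hmaps : MapsTo (fun t : ℝ => c * t) (Icc 0 1) (Icc 0 b) := fun t ht =>
    ⟨mul_nonneg hc ht.1, (mul_le_of_le_one_right hc ht.2).trans hcb⟩
  intro t ht
  obtain ⟨h1, h2, h3⟩ := h _ (hmaps ht)
  have hm : HasDerivWithinAt (fun t : ℝ => c * t) c (Icc 0 1) t := by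
    simpa using ((hasDerivAt_id t).const_mul c).hasDerivWithinAt
  refine ⟨h1, h2.scomp t hm hmaps, ?_⟩
  rw [christoffel_smul]
  have := (h3.scomp t hm hmaps).const_smul c
  rwa [smul_smul, smul_neg] at this

/-- Being a geodesic is tested in all charts, but one suffices: the second derivative of the
transition map that appears in the new acceleration is the inhomogeneous term of
`christoffel_transition`. -/
lemma IsChartSolution.isGeodesicOn [IsManifold 𝓘(ℝ, E) 2 M] [FiniteDimensional ℝ E]
    {g : Metric E M} {e : OpenPartialHomeomorph M E} (he : e ∈ atlas E M) {x w : ℝ → E}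
    {s : Set ℝ} (h : IsChartSolution g e x w s) : IsGeodesicOn g (e.symm ∘ x) s := by
  refine ⟨fun t ht => (e.continuousAt_symm (h t ht).1).comp_continuousWithinAt
    (h t ht).2.1.continuousWithinAt, fun e' he' => ?_⟩
  refine ⟨fun t => fderiv ℝ (e' ∘ e.symm) (x t) (w t), fun t ht hsource => ?_⟩
  obtain ⟨hx, hx', hw'⟩ := h t ht
  have hτ := contDiffAt_transition (IsManifold.subset_maximalAtlas (I := 𝓘(ℝ, E)) (n := 2) he)
      (IsManifold.subset_maximalAtlas he') hx hsource
  have hτ1 : DifferentiableAt ℝ (fderiv ℝ (e' ∘ e.symm)) (x t) :=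
    (hτ.fderiv_right (m := 1) (by norm_num)).differentiableAt one_ne_zero
  refine ⟨(hτ.differentiableAt two_ne_zero).hasFDerivAt.comp_hasDerivWithinAt t hx', ?_⟩
  have h1 := (hτ1.hasFDerivAt.comp_hasDerivWithinAt t hx').clm_apply hw'
  have h2 := christoffel_transition g he he' hx hsource (w t) (w t)
  refine h1.congr_deriv ?_
  change _ + fderiv ℝ (e' ∘ e.symm) (x t) _ = -christoffel g e' ((e' ∘ e.symm) (x t)) _ _
  rw [map_neg, h2]
  abel

lemma exists_lipschitzOnWith_spray [IsManifold 𝓘(ℝ, E) 2 M] [FiniteDimensional ℝ E]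
    (g : Metric E M) {e : OpenPartialHomeomorph M E} (he : e ∈ atlas E M) {y : E}
    (hy : y ∈ e.target) (w : E) :
    ∃ K, ∃ t ∈ 𝓝 (y, w),
      LipschitzOnWith K (fun p : E × E => (p.2, -christoffel g e p.1 p.2 p.2)) t := by
  obtain ⟨K, t, ht, hK⟩ := exists_lipschitzOnWith_christoffel g he hy w
  exact ⟨_, t, ht, LipschitzWith.prod_snd.lipschitzOnWith.prodMk hK.neg⟩

/-- Geodesics in a chart exist for a uniform, arbitrarily short time, for small velocities. -/
lemma exists_isChartSolution [IsManifold 𝓘(ℝ, E) 2 M] [FiniteDimensional ℝ E]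
    (g : Metric E M) {e : OpenPartialHomeomorph M E} (he : e ∈ atlas E M) {y : E}
    (hy : y ∈ e.target) {N : Set (E × E)} (hN : N ∈ 𝓝 (y, (0 : E))) {τ : ℝ} (hτ : 0 < τ) :
    ∃ T, 0 < T ∧ T < τ ∧ ∃ r > 0, ∀ v : E, ‖v‖ ≤ r → ∃ x w : ℝ → E, x 0 = y ∧ w 0 = v ∧
      IsChartSolution g e x w (Icc 0 T) ∧ ∀ s ∈ Icc 0 T, (x s, w s) ∈ N := by
  have : CompleteSpace E := FiniteDimensional.complete ℝ E
  obtain ⟨K, t, ht, hK⟩ := exists_lipschitzOnWith_spray g he hy 0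
  obtain ⟨T, hT0, hTτ, r, hr, H⟩ := exists_solution_mem ht hK
    (Filter.inter_mem hN (continuousAt_fst.preimage_mem_nhds (e.open_target.mem_nhds hy))) hτ
  refine ⟨T, hT0, hTτ, r, hr, fun v hv => ?_⟩
  obtain ⟨α, hα0, hα⟩ := H (y, v) (by simpa [Prod.dist_eq, hr.le] using hv)
  refine ⟨fun s => (α s).1, fun s => (α s).2, by simp [hα0], by simp [hα0], fun s hs => ?_,
    fun s hs => (hα s hs).2.1⟩
  have hd := (hα s hs).1
  exact ⟨(hα s hs).2.2,
    (ContinuousLinearMap.fst ℝ E E).hasFDerivAt.comp_hasDerivWithinAt s hd,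
    (ContinuousLinearMap.snd ℝ E E).hasFDerivAt.comp_hasDerivWithinAt s hd⟩

/-- Uniqueness of geodesics, when one of them stays in a chart. -/
lemma IsChartSolution.eq_of_isGeodesicOn [IsManifold 𝓘(ℝ, E) 2 M] [FiniteDimensional ℝ E]
    [T2Space M] {g : Metric E M} {e : OpenPartialHomeomorph M E} (he : e ∈ atlas E M)
    {x w : ℝ → E} (h : IsChartSolution g e x w (Icc 0 1)) {γ : ℝ → M}
    (hγ : IsGeodesicOn g γ (Icc 0 1)) (h0 : γ 0 = e.symm (x 0))
    (hv : HasDerivWithinAt (e ∘ γ) (w 0) (Icc 0 1) 0) {t : ℝ} (ht : t ∈ Icc (0 : ℝ) 1) :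
    γ t = e.symm (x t) := by
  obtain ⟨hcont, hγ⟩ := hγ
  obtain ⟨w', hw'⟩ := hγ e he
  have hsrc : ∀ s ∈ Icc (0 : ℝ) 1, γ s = e.symm (x s) → γ s ∈ e.source := fun s hs hse =>
    hse ▸ e.map_target (h s hs).1
  have h01 : (0 : ℝ) ∈ Icc (0 : ℝ) 1 := left_mem_Icc.2 zero_le_one
  -- Continuity argument on `[0, 1]`: agreement of position and velocity is a closed condition,
  -- holds at `0`, and propagates to the right by uniqueness for the first order system.
  let S : Set ℝ := {s | γ s = e.symm (x s) ∧ w' s = w s}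
  suffices hS : Icc 0 1 ⊆ S from (hS ht).1
  have hxc : ∀ s ∈ Icc (0 : ℝ) 1, ContinuousWithinAt (e.symm ∘ x) (Icc 0 1) s := fun s hs =>
    (e.continuousAt_symm (h s hs).1).comp_continuousWithinAt (h s hs).2.1.continuousWithinAt
  refine IsClosed.Icc_subset_of_forall_mem_nhdsWithin ?_ ?_ ?_
  · refine isClosed_of_closure_subset fun s (hs : s ∈ closure (S ∩ Icc (0 : ℝ) 1)) => ?_
    have hsI : s ∈ Icc (0 : ℝ) 1 := closure_minimal inter_subset_right isClosed_Icc hs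
    have hne : (𝓝[S ∩ Icc (0 : ℝ) 1] s).NeBot := mem_closure_iff_nhdsWithin_neBot.1 hs
    -- Positions come first, by the Hausdorff property: a priori `γ` may leave the chart, and `w'`
    -- is known to be continuous at `s` only once `γ s` lies in the chart domain.
    have hγs : γ s = e.symm (x s) := by
      refine tendsto_nhds_unique_of_eventuallyEq (l := 𝓝[S ∩ Icc (0 : ℝ) 1] s) ((hcont s hsI).mono inter_subset_right)
        ((hxc s hsI).mono inter_subset_right) ?_
      filter_upwards [self_mem_nhdsWithin] with r hr using hr.1.1
    refine ⟨⟨hγs, ?_⟩, hsI⟩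
    refine tendsto_nhds_unique_of_eventuallyEq (l := 𝓝[S ∩ Icc (0 : ℝ) 1] s)
      ((hw' s hsI (hsrc s hsI hγs)).2.continuousWithinAt.mono inter_subset_right)
      ((h s hsI).2.2.continuousWithinAt.mono inter_subset_right) ?_
    filter_upwards [self_mem_nhdsWithin] with r hr using hr.1.2
  · refine ⟨h0, ?_⟩
    have hu : UniqueDiffWithinAt ℝ (Icc (0 : ℝ) 1) 0 := uniqueDiffOn_Icc zero_lt_one 0 h01
    exact hu.eq_deriv _ (hw' 0 h01 (hsrc 0 h01 h0)).1 hv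
  · rintro s ⟨⟨hs1, hs2⟩, hsI⟩
    have hsI' : s ∈ Icc (0 : ℝ) 1 := Ico_subset_Icc_self hsI
    have hss := hsrc s hsI' hs1
    obtain ⟨K, Q, hQ, hK⟩ := exists_lipschitzOnWith_spray g he (h s hsI').1 (w s)
    have hc1 : ContinuousWithinAt (fun r => (x r, w r)) (Icc 0 1) s :=
      (h s hsI').2.1.continuousWithinAt.prodMk (h s hsI').2.2.continuousWithinAt
    have hc2 : ContinuousWithinAt (fun r => ((e ∘ γ) r, w' r)) (Icc 0 1) s :=
      (hw' s hsI' hss).1.continuousWithinAt.prodMk (hw' s hsI' hss).2.continuousWithinAt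
    have heq : ((e ∘ γ) s, w' s) = (x s, w s) := by
      rw [hs2, Function.comp_apply, hs1, e.right_inv (h s hsI').1]
    have hev : ∀ᶠ r in 𝓝[≥] s, r ∈ Icc (0 : ℝ) 1 ∧ (x r, w r) ∈ Q ∧ ((e ∘ γ) r, w' r) ∈ Q ∧
        γ r ∈ e.source := by
      have hle : 𝓝[≥] s ≤ 𝓝[Icc 0 1] s := by
        rw [← nhdsWithin_Icc_eq_nhdsGE hsI.2]
        exact nhdsWithin_mono _ (Icc_subset_Icc_left hsI.1)
      refine Filter.Eventually.filter_mono hle ?_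
      have hmem : ∀ᶠ r in 𝓝[Icc 0 1] s, r ∈ Icc (0 : ℝ) 1 := self_mem_nhdsWithin
      refine hmem.and ((hc1.eventually_mem hQ).and ((hc2.eventually_mem ?_).and
        ((hcont s hsI').eventually_mem (e.open_source.mem_nhds hss))))
      change Q ∈ 𝓝 ((e ∘ γ) s, w' s)
      rwa [heq]
    obtain ⟨b, hb, hbI⟩ := mem_nhdsGE_iff_exists_Icc_subset.1 hev
    have hder : ∀ {c : ℝ → E × E} {c' : E × E} {r : ℝ}, r ∈ Ico s b →
        HasDerivWithinAt c c' (Icc 0 1) r → HasDerivWithinAt c c' (Ici r) r := by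
      intro c c' r hr hc
      have hb1 : b ≤ 1 := (hbI (right_mem_Icc.2 (le_of_lt hb))).1.2
      exact hc.mono_of_mem_nhdsWithin
        (Icc_mem_nhdsGE_of_mem ⟨hsI.1.trans hr.1, hr.2.trans_le hb1⟩)
    have hd1 : ∀ r ∈ Icc s b, HasDerivWithinAt (fun r => (x r, w r))
        (w r, -christoffel g e (x r) (w r) (w r)) (Icc 0 1) r := fun r hr =>
      (h r (hbI hr).1).2.1.prodMk (h r (hbI hr).1).2.2
    have hd2 : ∀ r ∈ Icc s b, HasDerivWithinAt (fun r => ((e ∘ γ) r, w' r))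
        (w' r, -christoffel g e ((e ∘ γ) r) (w' r) (w' r)) (Icc 0 1) r := fun r hr =>
      (hw' r (hbI hr).1 (hbI hr).2.2.2).1.prodMk (hw' r (hbI hr).1 (hbI hr).2.2.2).2
    have hsub : Icc s b ⊆ Icc (0 : ℝ) 1 := fun r hr => (hbI hr).1
    have key := ODE_solution_unique_of_mem_Icc_right (a := s) (b := b) (K := K) (s := fun _ => Q)
      (v := fun _ (p : E × E) => (p.2, -christoffel g e p.1 p.2 p.2))
      (f := fun r => ((e ∘ γ) r, w' r)) (g := fun r => (x r, w r))
      (fun _ _ => hK) (fun r hr => (hd2 r hr).continuousWithinAt.mono hsub)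
      (fun r hr => hder hr (hd2 r (Ico_subset_Icc_self hr)))
      (fun r hr => (hbI (Ico_subset_Icc_self hr)).2.2.1)
      (fun r hr => (hd1 r hr).continuousWithinAt.mono hsub)
      (fun r hr => hder hr (hd1 r (Ico_subset_Icc_self hr)))
      (fun r hr => (hbI (Ico_subset_Icc_self hr)).2.1) heq
    filter_upwards [Ioc_mem_nhdsGT hb] with r hr
    have hr' : r ∈ Icc s b := Ioc_subset_Icc_self hr
    have := key hr'
    simp only [Prod.mk.injEq, Function.comp_apply] at this
    exact ⟨by rw [← this.1, e.left_inv (hbI hr').2.2.2], this.2⟩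

end Geodesic

/-! ### A comparison principle -/

section Comparison

lemma mul_sub_le_of_le_hasDerivWithinAt {f f' : ℝ → ℝ} {a b c : ℝ} (hab : a ≤ b)
    (h : ∀ t ∈ Icc a b, HasDerivWithinAt f (f' t) (Icc a b) t) (hc : ∀ t ∈ Ioo a b, c ≤ f' t) :
    c * (b - a) ≤ f b - f a := by
  rcases hab.eq_or_lt with rfl | hlt
  · simp
  obtain ⟨t, ht, hft⟩ := exists_hasDerivAt_eq_slope f f' hlt
    (fun t ht => (h t ht).continuousWithinAt)
    (fun t ht => (h t (Ioo_subset_Icc_self ht)).hasDerivAt (Icc_mem_nhds ht.1 ht.2))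
  have := hc t ht
  rw [hft, le_div_iff₀ (by linarith)] at this
  exact this

/-- A comparison principle for a second order differential inequality on short intervals. -/
lemma nonneg_of_second_deriv_ge {f f' f'' : ℝ → ℝ} {C T : ℝ} (hT : 0 ≤ T) (hC : 0 ≤ C)
    (hCT : C * (T + 1) * T < 1)
    (hf : ∀ t ∈ Icc 0 T, HasDerivWithinAt f (f' t) (Icc 0 T) t)
    (hf' : ∀ t ∈ Icc 0 T, HasDerivWithinAt f' (f'' t) (Icc 0 T) t)
    (h0 : f 0 = 0) (h0' : f' 0 = 0)
    (hineq : ∀ t ∈ Icc 0 T, -C * (|f t| + |f' t|) ≤ f'' t) : 0 ≤ f T := by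
  by_contra! hneg
  have hfc : ContinuousOn f (Icc 0 T) := fun t ht => (hf t ht).continuousWithinAt
  have hfc' : ContinuousOn f' (Icc 0 T) := fun t ht => (hf' t ht).continuousWithinAt
  -- Restart at a maximum point of `f`. There `f' = 0`, also when it is the left endpoint, and it is
  -- not `T` because `f T < 0 = f 0`.
  obtain ⟨t₀, ht₀, hmax⟩ := isCompact_Icc.exists_isMaxOn (nonempty_Icc.2 hT) hfc
  have hm0 : 0 ≤ f t₀ := h0 ▸ hmax (left_mem_Icc.2 hT)
  have ht₀T : t₀ < T := ht₀.2.lt_of_ne (by rintro rfl; linarith)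
  have hd0 : f' t₀ = 0 := by
    rcases ht₀.1.eq_or_lt with rfl | hpos
    · exact h0'
    · have hnhds : Icc 0 T ∈ 𝓝 t₀ := Icc_mem_nhds hpos ht₀T
      exact (hmax.isLocalMax hnhds).hasDerivAt_eq_zero ((hf t₀ ht₀).hasDerivAt hnhds)
  have hsub : Icc t₀ T ⊆ Icc 0 T := Icc_subset_Icc_left ht₀.1
  obtain ⟨t₂, ht₂, hmin⟩ := isCompact_Icc.exists_isMinOn (nonempty_Icc.2 ht₀T.le) (hfc'.mono hsub)
  set K := -f' t₂ with hK
  have hge : ∀ t ∈ Icc t₀ T, -K ≤ f' t := fun t ht => by rw [hK, neg_neg]; exact hmin ht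
  have hK0 : 0 ≤ K := by have := hge t₀ (left_mem_Icc.2 ht₀T.le); linarith
  have hlow : ∀ t ∈ Icc t₀ T, f t₀ - K * T ≤ f t := by
    intro t ht
    have := mul_sub_le_of_le_hasDerivWithinAt (f := f) (f' := f') (c := -K) ht.1
      (fun s hs => (hf s ⟨ht₀.1.trans hs.1, hs.2.trans ht.2⟩).mono
        (Icc_subset_Icc ht₀.1 ht.2)) (fun s hs => hge s ⟨hs.1.le, hs.2.le.trans ht.2⟩)
    have h2 : K * (t - t₀) ≤ K * T := by
      apply mul_le_mul_of_nonneg_left _ hK0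
      linarith [ht.2, ht₀.1]
    linarith
  -- To become negative, `f` must descend by more than its maximum at a rate at most `K`; hence `K *
  -- T` bounds `|f|` on `[t₀, T]`.
  have hmKT : f t₀ < K * T := by
    have := hlow T (right_mem_Icc.2 ht₀T.le); linarith
  have hKpos : 0 < K := by
    rcases hK0.eq_or_lt with h | h
    · rw [← h] at hmKT; linarith
    · exact h
  have habs : ∀ t ∈ Icc t₀ T, |f t| ≤ K * T := fun t ht => by
    have h1 := hlow t ht
    have h2 : f t ≤ f t₀ := hmax (hsub ht)
    rw [abs_le]; constructor <;> linarith
  -- the last time before `t₂` at which `f'` is nonnegative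
  have hcpt : IsCompact {r ∈ Icc t₀ t₂ | 0 ≤ f' r} := by
    have hc : ContinuousOn f' (Icc t₀ t₂) := hfc'.mono (Icc_subset_Icc ht₀.1 ht₂.2)
    exact isCompact_Icc.of_isClosed_subset (hc.preimage_isClosed_of_isClosed isClosed_Icc
      isClosed_Ici) (fun r hr => hr.1)
  obtain ⟨s, ⟨hs, hs0⟩, hsmax⟩ := hcpt.exists_isGreatest ⟨t₀, left_mem_Icc.2 ht₂.1, hd0.ge⟩
  have hbound : ∀ r ∈ Ioo s t₂, -C * (K * T + K) ≤ f'' r := by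
    intro r hr
    have hr1 : r ∈ Icc t₀ T := ⟨hs.1.trans hr.1.le, hr.2.le.trans ht₂.2⟩
    have hneg' : f' r < 0 := by
      by_contra! hc
      exact absurd (hsmax ⟨⟨hr1.1, hr.2.le⟩, hc⟩) (not_le.2 hr.1)
    have h1 : |f' r| ≤ K := by
      rw [abs_of_neg hneg']; linarith [hge r hr1]
    have h2 := hineq r (hsub hr1)
    have h3 : C * (|f r| + |f' r|) ≤ C * (K * T + K) :=
      mul_le_mul_of_nonneg_left (add_le_add (habs r hr1) h1) hC
    linarith
  -- On `[s, t₂]` the derivative falls from a nonnegative value to `-K`, while the inequality allows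
  -- a drop of at most `C * K * (T + 1) * T < K`.
  have hfin := mul_sub_le_of_le_hasDerivWithinAt (f := f') (f' := f'') hs.2
    (fun r hr => (hf' r ⟨ht₀.1.trans (hs.1.trans hr.1), hr.2.trans ht₂.2⟩).mono
      (Icc_subset_Icc (ht₀.1.trans hs.1) ht₂.2)) hbound
  have h4 : C * (K * T + K) * (t₂ - s) ≤ C * (K * T + K) * T := by
    apply mul_le_mul_of_nonneg_left _ (by positivity)
    linarith [ht₂.2, hs.1, ht₀.1]
  have h5 : K * (C * (T + 1) * T) < K * 1 := mul_lt_mul_of_pos_left hCT hKpos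
  nlinarith

end Comparison

/-! ### The height over a hypersurface -/

section Graph

variable {E : Type*} [NormedAddCommGroup E] [NormedSpace ℝ E]

/-- Near a regular point, the zero set of a `C²` function `F` is a graph over a hyperplane. The
function `ψ` is the height over that graph in the direction of `n`. -/
lemma exists_height [CompleteSpace E] {F : E → ℝ} {y₀ : E} (hF : ContDiffAt ℝ 2 F y₀)
    (h0 : F y₀ = 0) (hd : fderiv ℝ F y₀ ≠ 0) :
    ∃ (n : E) (ψ : E → ℝ), fderiv ℝ F y₀ n = 1 ∧ (∀ (x : E) (s : ℝ), ψ (x + s • n) = ψ x + s) ∧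
      ContDiffAt ℝ 2 ψ y₀ ∧ ψ y₀ = 0 ∧ ∀ᶠ x in 𝓝 y₀, F (x - ψ x • n) = 0 := by
  set l := fderiv ℝ F y₀ with hl
  obtain ⟨m, hm⟩ : ∃ m, l m ≠ 0 := by
    by_contra! h; exact hd (ContinuousLinearMap.ext h)
  set n := (l m)⁻¹ • m with hn
  have hln : l n = 1 := by simp [hn, hm]
  -- `P` projects along `n` onto the affine hyperplane through `y₀` parallel to the kernel of `l`.
  -- Replacing the coordinate along `n` by `F` gives `Θ`, whose differential at `y₀` is the
  -- identity.
  let P : E → E := fun x => x - l (x - y₀) • n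
  let Θ : E → E := fun x => P x + F x • n
  have hP : ContDiff ℝ 2 P :=
    contDiff_id.sub ((l.contDiff.comp (contDiff_id.sub contDiff_const)).smul contDiff_const)
  have hΘ : ContDiffAt ℝ 2 Θ y₀ := hP.contDiffAt.add (hF.smul contDiffAt_const)
  have hP0 : P y₀ = y₀ := by simp [P]
  have hΘ0 : Θ y₀ = y₀ := by simp [Θ, hP0, h0]
  have hΘ' : HasFDerivAt Θ ((ContinuousLinearEquiv.refl ℝ E : E ≃L[ℝ] E) : E →L[ℝ] E) y₀ := by
    have h1 : HasFDerivAt P (ContinuousLinearMap.id ℝ E - l.smulRight n) y₀ := by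
      have := (l.hasFDerivAt.comp y₀ ((hasFDerivAt_id y₀).sub_const y₀)).smul_const n
      exact (hasFDerivAt_id y₀).sub this
    have h2 : HasFDerivAt (fun x => F x • n) (l.smulRight n) y₀ :=
      (hF.differentiableAt two_ne_zero).hasFDerivAt.smul_const n
    refine (h1.add h2).congr_fderiv ?_
    ext v; simp
  let θ := hΘ.toOpenPartialHomeomorph Θ hΘ' two_ne_zero
  have hθ : ∀ x, θ x = Θ x := fun x => rfl
  have hy₀ : y₀ ∈ θ.source := hΘ.mem_toOpenPartialHomeomorph_source hΘ' two_ne_zero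
  have hθinv : θ.symm y₀ = y₀ := by
    conv_lhs => rw [← hΘ0]
    exact θ.left_inv hy₀
  have hy₀t : y₀ ∈ θ.target := by
    have := θ.map_source hy₀
    rwa [hθ, hΘ0] at this
  have hsymm : ContDiffAt ℝ 2 θ.symm y₀ := by
    have := hΘ.to_localInverse hΘ' two_ne_zero
    rw [hΘ0] at this
    exact this
  -- Near `y₀`, `θ.symm (P x)` is the zero of `F` on the line through `x` in direction `n`. Since
  -- `P` is constant on such lines, `ψ (x + s • n) = ψ x + s` holds for all `x`, even where `θ.symm`
  -- takes meaningless values.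
  let ψ : E → ℝ := fun x => l x - l (θ.symm (P x))
  refine ⟨n, ψ, hln, ?_, ?_, ?_, ?_⟩
  · intro x s
    have : P (x + s • n) = P x := by
      simp only [P, map_sub, map_add, map_smul, hln, smul_eq_mul, mul_one, add_smul, sub_smul]
      abel
    simp only [ψ, this, map_add, map_smul, hln, smul_eq_mul, mul_one]
    ring
  · refine l.contDiff.contDiffAt.sub (l.contDiff.contDiffAt.comp y₀ ?_)
    refine ContDiffAt.comp y₀ ?_ hP.contDiffAt
    rw [hP0]; exact hsymm
  · simp [ψ, hP0, hθinv]
  · have hev : ∀ᶠ x in 𝓝 y₀, P x ∈ θ.target :=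
      hP.continuous.continuousAt.eventually (by rw [hP0]; exact θ.open_target.mem_nhds hy₀t)
    filter_upwards [hev] with x hx
    set z := θ.symm (P x) with hz
    have h1 : Θ z = P x := θ.right_inv hx
    have h2 : F z = 0 := by
      have h3 : l (Θ z - y₀) = F z := by
        simp only [Θ, P, map_sub, map_add, map_smul, hln, smul_eq_mul, mul_one]
        ring
      rw [← h3, h1]
      simp only [P, map_sub, map_smul, hln, smul_eq_mul, mul_one]
      ring
    have h4 : z = x - ψ x • n := by
      simp only [Θ, P, h2, zero_smul, add_zero] at h1
      have h5 : z = x - l (x - y₀) • n + l (z - y₀) • n := by rw [← h1]; abel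
      conv_lhs => rw [h5]
      simp only [ψ, ← hz, map_sub, sub_smul]
      abel
    rw [← h4, h2]

variable {ψ : E → ℝ} {n : E}

/-- A translation along `n` changes `ψ` by a constant, so derivatives of `ψ` at a point and at its
foot point coincide; the next lemma is the same for second derivatives. -/
lemma fderiv_eq_of_add_smul (hψ : ∀ (x : E) (s : ℝ), ψ (x + s • n) = ψ x + s) (x : E) (s : ℝ) :
    fderiv ℝ ψ (x + s • n) = fderiv ℝ ψ x := by
  rw [← fderiv_comp_add_right]
  simp_rw [hψ]
  rw [fderiv_add_const]

lemma fderiv_fderiv_eq_of_add_smul (hψ : ∀ (x : E) (s : ℝ), ψ (x + s • n) = ψ x + s)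
    (x : E) (s : ℝ) : fderiv ℝ (fderiv ℝ ψ) (x + s • n) = fderiv ℝ (fderiv ℝ ψ) x := by
  rw [← fderiv_comp_add_right]
  simp_rw [fderiv_eq_of_add_smul hψ]

lemma fderiv_apply_eq_one (hψ : ∀ (x : E) (s : ℝ), ψ (x + s • n) = ψ x + s) {x : E}
    (hx : DifferentiableAt ℝ ψ x) : fderiv ℝ ψ x n = 1 := by
  have h1 : HasDerivAt (fun s : ℝ => x + s • n) n 0 := by
    simpa using ((hasDerivAt_id (0 : ℝ)).smul_const n).const_add x
  have h2 : HasDerivAt (fun s : ℝ => ψ (x + s • n)) (fderiv ℝ ψ x n) 0 :=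
    HasFDerivAt.comp_hasDerivAt (0 : ℝ) (by simpa using hx.hasFDerivAt) h1
  simp_rw [hψ] at h2
  exact h2.unique ((hasDerivAt_id (0 : ℝ)).const_add _)

lemma fderiv_fderiv_apply_eq_zero (hψ : ∀ (x : E) (s : ℝ), ψ (x + s • n) = ψ x + s) {x : E}
    (hx : ContDiffAt ℝ 2 ψ x) : fderiv ℝ (fderiv ℝ ψ) x n = 0 := by
  have hd : DifferentiableAt ℝ (fderiv ℝ ψ) x :=
    (hx.fderiv_right (m := 1) (by norm_num)).differentiableAt one_ne_zero
  have h1 : HasDerivAt (fun s : ℝ => x + s • n) n 0 := by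
    simpa using ((hasDerivAt_id (0 : ℝ)).smul_const n).const_add x
  have h2 : HasDerivAt (fun s : ℝ => fderiv ℝ ψ (x + s • n)) (fderiv ℝ (fderiv ℝ ψ) x n) 0 :=
    HasFDerivAt.comp_hasDerivAt (0 : ℝ) (by simpa using hd.hasFDerivAt) h1
  simp_rw [fderiv_eq_of_add_smul hψ] at h2
  exact h2.unique (hasDerivAt_const _ _)

end Graph

/-! ### Geodesics starting tangentially to an infinitesimally convex hypersurface -/

section Core

variable {E : Type*} [NormedAddCommGroup E] [NormedSpace ℝ E]
  {M : Type*} [TopologicalSpace M] [ChartedSpace E M]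

/-- The coordinate expression of the Hessian quadratic form of a function `f` in the chart `e`. -/
def chartHessian (g : Metric E M) (e : OpenPartialHomeomorph M E) (f : E → ℝ) (y u : E) : ℝ :=
  fderiv ℝ (fderiv ℝ f) y u u - fderiv ℝ f y (christoffel g e y u u)

/-- The first and second derivatives of a function along a geodesic. -/
lemma IsChartSolution.hasDerivWithinAt_comp {g : Metric E M} {e : OpenPartialHomeomorph M E}
    {x w : ℝ → E} {s : Set ℝ} (h : IsChartSolution g e x w s) {f : E → ℝ} {t : ℝ} (ht : t ∈ s)
    (hf : ContDiffAt ℝ 2 f (x t)) :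
    HasDerivWithinAt (fun r => f (x r)) (fderiv ℝ f (x t) (w t)) s t ∧
      HasDerivWithinAt (fun r => fderiv ℝ f (x r) (w r)) (chartHessian g e f (x t) (w t)) s t := by
  obtain ⟨-, h1, h2⟩ := h t ht
  have hd : DifferentiableAt ℝ (fderiv ℝ f) (x t) :=
    (hf.fderiv_right (m := 1) (by norm_num)).differentiableAt one_ne_zero
  refine ⟨(hf.differentiableAt two_ne_zero).hasFDerivAt.comp_hasDerivWithinAt t h1, ?_⟩
  refine ((hd.hasFDerivAt.comp_hasDerivWithinAt t h1).clm_apply h2).congr_deriv ?_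
  change _ + fderiv ℝ f (x t) _ = _
  rw [map_neg, chartHessian, sub_eq_add_neg]

/-- Differentiate `F (x - ψ x • n) = 0` once and twice. On tangential vectors the second derivatives
of `F` and `ψ` are thus proportional with the same factor as the first ones, so the sign of the
Hessian passes from `F` to `ψ`. -/
lemma fderiv_of_height {F ψ : E → ℝ} {n y : E} (hF : ContDiffAt ℝ 2 F y)
    (hψ : ContDiffAt ℝ 2 ψ y) (hy : ψ y = 0) (hev : ∀ᶠ x in 𝓝 y, F (x - ψ x • n) = 0) (u : E) :
    fderiv ℝ F y u = fderiv ℝ F y n * fderiv ℝ ψ y u ∧ (fderiv ℝ ψ y u = 0 →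
      fderiv ℝ (fderiv ℝ F) y u u = fderiv ℝ F y n * fderiv ℝ (fderiv ℝ ψ) y u u) := by
  set τ : E → E := fun x => x - ψ x • n with hτdef
  have hτ : ContDiffAt ℝ 2 τ y := contDiffAt_id.sub (hψ.smul contDiffAt_const)
  have hτy : τ y = y := by simp [hτdef, hy]
  have hzero : F ∘ τ =ᶠ[𝓝 y] fun _ => 0 := hev
  have hτ' : ∀ x, ContDiffAt ℝ 2 ψ x → ∀ v, fderiv ℝ τ x v = v - fderiv ℝ ψ x v • n := by
    intro x hx v
    have h1 : HasFDerivAt τ _ x :=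
      (hasFDerivAt_id x).sub ((hx.differentiableAt two_ne_zero).hasFDerivAt.smul_const n)
    rw [h1.fderiv]; simp
  have hτ'' : fderiv ℝ (fderiv ℝ τ) y u u = -(fderiv ℝ (fderiv ℝ ψ) y u u • n) := by
    have hd : DifferentiableAt ℝ (fderiv ℝ ψ) y :=
      (hψ.fderiv_right (m := 1) (by norm_num)).differentiableAt one_ne_zero
    have hdτ : DifferentiableAt ℝ (fderiv ℝ τ) y :=
      (hτ.fderiv_right (m := 1) (by norm_num)).differentiableAt one_ne_zero
    have h1 := hdτ.hasFDerivAt.clm_apply (hasFDerivAt_const u y)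
    have h2 := (hasFDerivAt_const u y).sub
      ((hd.hasFDerivAt.clm_apply (hasFDerivAt_const u y)).smul_const n)
    have h3 : (fun x => fderiv ℝ τ x u) =ᶠ[𝓝 y] fun x => u - fderiv ℝ ψ x u • n := by
      filter_upwards [hψ.eventually (by simp)] with x hx using hτ' x hx u
    have h4 := congrArg (fun L : E →L[ℝ] E => L u) (h1.unique (h2.congr_of_eventuallyEq h3))
    simpa using h4
  have hFτ : ContDiffAt ℝ 2 F (τ y) := by rwa [hτy]
  constructor
  · have h1 := fderiv_comp y (hFτ.differentiableAt two_ne_zero) (hτ.differentiableAt two_ne_zero)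
    rw [hzero.fderiv_eq, hτy] at h1
    have h2 := congrArg (fun L : E →L[ℝ] ℝ => L u) h1
    simp [hτ' y hψ] at h2
    linarith
  · intro hu
    have h1 := fderiv_fderiv_comp hFτ hτ u u
    have h2 : fderiv ℝ (F ∘ τ) =ᶠ[𝓝 y] fun _ => 0 :=
      (hzero.fderiv (𝕜 := ℝ)).trans (Filter.Eventually.of_forall fun x => by simp)
    rw [h2.fderiv_eq, hτy, hτ' y hψ, hu, hτ''] at h1
    simp at h1
    linarith

/-- Infinitesimal convexity of the level set `F = 0` near `y₀` keeps the geodesics that start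
tangentially at `y₀` on the side `0 ≤ F`. -/
lemma exists_nhds_forall_nonneg [IsManifold 𝓘(ℝ, E) 2 M] [FiniteDimensional ℝ E]
    (g : Metric E M) {e : OpenPartialHomeomorph M E} (he : e ∈ atlas E M) {y₀ : E}
    (hy₀ : y₀ ∈ e.target) {F : E → ℝ} (hF : ContDiffAt ℝ 2 F y₀) (h0 : F y₀ = 0)
    (hd : fderiv ℝ F y₀ ≠ 0) (hconv : ∀ᶠ y in 𝓝 y₀, F y = 0 → ∀ u, fderiv ℝ F y u = 0 →
      0 ≤ chartHessian g e F y u) :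
    ∃ N ∈ 𝓝 (y₀, (0 : E)), ∃ τ > 0, ∀ T, 0 < T → T < τ → ∀ x w : ℝ → E,
      IsChartSolution g e x w (Icc 0 T) → (∀ t ∈ Icc 0 T, (x t, w t) ∈ N) → x 0 = y₀ →
      fderiv ℝ F y₀ (w 0) = 0 → 0 ≤ F (x T) := by
  have : CompleteSpace E := FiniteDimensional.complete ℝ E
  obtain ⟨n, ψ, hn, hψ, hψ2, hψ0, hgraph⟩ := exists_height hF h0 hd
  obtain ⟨K, t, ht, hK⟩ := exists_lipschitzOnWith_christoffel g he hy₀ 0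
  have hFev : ∀ᶠ y in 𝓝 y₀, ContDiffAt ℝ 2 F y := hF.eventually (by simp)
  have hψev : ∀ᶠ y in 𝓝 y₀, ContDiffAt ℝ 2 ψ y := hψ2.eventually (by simp)
  have hdF : ContinuousAt (fderiv ℝ F) y₀ :=
    (hF.fderiv_right (m := 1) (by norm_num)).continuousAt
  have hdψ : ContinuousAt (fderiv ℝ ψ) y₀ :=
    (hψ2.fderiv_right (m := 1) (by norm_num)).continuousAt
  have hnev : ∀ᶠ y in 𝓝 y₀, 0 < fderiv ℝ F y n :=
    (hdF.clm_apply continuousAt_const).eventually (lt_mem_nhds (by simp [hn]))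
  obtain ⟨ρ, hρ, hball⟩ := Metric.eventually_nhds_iff_ball.1 (hFev.and hnev)
  set B := ‖fderiv ℝ ψ y₀‖ + 1 with hB
  have hBev : ∀ᶠ y in 𝓝 y₀, ‖fderiv ℝ ψ y‖ ≤ B :=
    (hdψ.norm.eventually (gt_mem_nhds (lt_add_one _))).mono fun _ h => le_of_lt h
  -- the foot point on the graph and the tangential part of the velocity
  let A : E × E → E × E := fun p => (p.1 - ψ p.1 • n, p.2 - fderiv ℝ ψ p.1 p.2 • n)
  have hA0 : A (y₀, 0) = (y₀, 0) := by simp [A, hψ0]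
  have hA : Filter.Tendsto A (𝓝 (y₀, 0)) (𝓝 (y₀, 0)) := by
    have hc1 : ContinuousAt (fun p : E × E => ψ p.1) (y₀, 0) :=
      ContinuousAt.comp (f := Prod.fst) hψ2.continuousAt continuousAt_fst
    have hc2 : ContinuousAt (fun p : E × E => fderiv ℝ ψ p.1) (y₀, 0) :=
      ContinuousAt.comp (f := Prod.fst) hdψ continuousAt_fst
    have : ContinuousAt A (y₀, 0) :=
      (continuousAt_fst.sub (hc1.smul continuousAt_const)).prodMk
        (continuousAt_snd.sub ((hc2.clm_apply continuousAt_snd).smul continuousAt_const))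
    have h := this.tendsto
    rwa [hA0] at h
  have hfst : Filter.Tendsto (Prod.fst : E × E → E) (𝓝 (y₀, 0)) (𝓝 y₀) := continuousAt_fst
  have hA1 : Filter.Tendsto (fun p => (A p).1) (𝓝 (y₀, 0)) (𝓝 y₀) := hfst.comp hA
  have hbn : ∀ᶠ y in 𝓝 y₀, y ∈ Metric.ball y₀ ρ := Metric.ball_mem_nhds y₀ hρ
  have htev : ∀ᶠ p in 𝓝 (y₀, (0 : E)), p ∈ t := ht
  have hN := (hfst.eventually (hψev.and (hBev.and (hbn.and hgraph)))).and
    ((hA1.eventually (hFev.and (hψev.and (hgraph.eventually_nhds.and (hconv.and (hnev.and hbn)))))).and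
      (htev.and (hA.eventually htev)))
  -- `K` is the Lipschitz constant of the Christoffel term, `B` bounds the differential of `ψ`, and
  -- `‖n‖` converts height and vertical speed into the distance between `(x, w)` and its projection
  -- `A (x, w)`.
  set C := B * (K * ‖n‖) with hC
  have hB0 : 0 ≤ B := by positivity
  have hC0 : 0 ≤ C := by positivity
  -- the differential inequality
  have hineq : ∀ᶠ p in 𝓝 (y₀, (0 : E)), ContDiffAt ℝ 2 ψ p.1 ∧ (0 ≤ ψ p.1 → 0 ≤ F p.1) ∧
      -C * (|ψ p.1| + |fderiv ℝ ψ p.1 p.2|) ≤ chartHessian g e ψ p.1 p.2 := by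
    filter_upwards [hN]
    rintro ⟨x, w⟩ ⟨⟨hx1, hx2, hx3, hx4⟩, ⟨hy1, hy2, hy3, hy4, hy5, hy6⟩, hxt, hAt⟩
    simp only at hx1 hx2 hx3 hx4
    set a := ψ x with ha
    set b := fderiv ℝ ψ x w with hb
    set y := x - a • n with hy
    set u := w - b • n with hu
    have hAxw : A (x, w) = (y, u) := rfl
    rw [hAxw] at hAt hy1 hy2 hy3 hy4 hy5 hy6
    simp only at hAt hy1 hy2 hy3 hy4 hy5 hy6
    have hxy : y = x + (-a) • n := by rw [hy, neg_smul, sub_eq_add_neg]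
    have hψy : ψ y = 0 := by rw [hxy, hψ]; ring
    have hdy : fderiv ℝ ψ y = fderiv ℝ ψ x := by rw [hxy, fderiv_eq_of_add_smul hψ]
    have hddy : fderiv ℝ (fderiv ℝ ψ) y = fderiv ℝ (fderiv ℝ ψ) x := by
      rw [hxy, fderiv_fderiv_eq_of_add_smul hψ]
    have hFy : F y = 0 := hx4
    have hψn := fderiv_apply_eq_one hψ (hx1.differentiableAt two_ne_zero)
    have hψu : fderiv ℝ ψ y u = 0 := by
      rw [hdy, hu, map_sub, map_smul, hψn, ← hb]; simp
    obtain ⟨hr1, hr2⟩ := fderiv_of_height hy1 hy2 hψy hy3 u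
    refine ⟨hx1, fun ha0 => ?_, ?_⟩
    -- The segment from the foot point `y` up to `x` stays in a ball where `F` increases in the
    -- direction `n`, and `F y = 0`.
    · have hseg : ∀ s ∈ Icc 0 a, y + s • n ∈ Metric.ball y₀ ρ := by
        intro s hs
        have : x = y + a • n := by rw [hy]; abel
        rcases ha0.eq_or_lt with h | h
        · have : s = 0 := le_antisymm (h ▸ hs.2) hs.1
          simpa [this] using hy6
        · have h2 := (convex_ball y₀ ρ).add_smul_sub_mem hy6 hx3 (t := s / a)
            ⟨div_nonneg hs.1 ha0, (div_le_one h).2 hs.2⟩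
          have h3 : (s / a) • (x - y) = s • n := by
            rw [this, add_sub_cancel_left, smul_smul, div_mul_cancel₀ _ h.ne']
          rwa [h3] at h2
      have hm := mul_sub_le_of_le_hasDerivWithinAt (f := fun s => F (y + s • n))
        (f' := fun s => fderiv ℝ F (y + s • n) n) (c := 0) ha0 (fun s hs => ?_) (fun s hs =>
          (hball _ (hseg s (Ioo_subset_Icc_self hs))).2.le)
      · have : y + a • n = x := by rw [hy]; abel
        simp only [zero_smul, add_zero, hFy, this] at hm
        linarith
      · have h1 : HasDerivAt (fun s : ℝ => y + s • n) n s := by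
          simpa using ((hasDerivAt_id s).smul_const n).const_add y
        exact (((hball _ (hseg s hs)).1.differentiableAt two_ne_zero).hasFDerivAt.comp_hasDerivAt
          s h1).hasDerivWithinAt
    · have hHess : 0 ≤ chartHessian g e ψ y u := by
        have h1 := hy4 hFy u (by rw [hr1, hψu, mul_zero])
        have h2 := (fderiv_of_height hy1 hy2 hψy hy3 (christoffel g e y u u)).1
        rw [chartHessian, hr2 hψu, h2, ← mul_sub] at h1
        exact nonneg_of_mul_nonneg_right h1 hy5
      -- The decisive equality: `n` lies in the kernel of the second derivative of `ψ`, which is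
      -- also constant along `n`. No modulus of continuity of second derivatives enters the
      -- estimate.
      have hww : fderiv ℝ (fderiv ℝ ψ) x w w = fderiv ℝ (fderiv ℝ ψ) y u u := by
        have hz := fderiv_fderiv_apply_eq_zero hψ hx1
        have hz' : fderiv ℝ (fderiv ℝ ψ) x w n = 0 := by
          rw [fderiv_fderiv_symm hx1, hz]; rfl
        rw [hddy, hu]
        simp [map_sub, hz, hz']
      have hdist : dist ((y, u) : E × E) (x, w) ≤ ‖n‖ * (|a| + |b|) := by
        rw [Prod.dist_eq]
        have h1 : dist y x = |a| * ‖n‖ := by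
          rw [dist_eq_norm, hy, sub_sub_cancel_left, norm_neg, norm_smul, Real.norm_eq_abs]
        have h2 : dist u w = |b| * ‖n‖ := by
          rw [dist_eq_norm, hu, sub_sub_cancel_left, norm_neg, norm_smul, Real.norm_eq_abs]
        have h3 : 0 ≤ |a| * ‖n‖ := by positivity
        have h4 : 0 ≤ |b| * ‖n‖ := by positivity
        simp only [h1, h2]
        exact max_le (by linarith) (by linarith)
      have hlip := hK.dist_le_mul _ hAt _ hxt
      rw [dist_eq_norm] at hlip
      have hop := (fderiv ℝ ψ x).le_opNorm
        (christoffel g e y u u - christoffel g e x w w)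
      have habs := neg_abs_le (fderiv ℝ ψ x (christoffel g e y u u - christoffel g e x w w))
      rw [Real.norm_eq_abs] at hop
      have hle : ‖fderiv ℝ ψ x‖ * ‖christoffel g e y u u - christoffel g e x w w‖ ≤
          C * (|a| + |b|) := by
        calc _ ≤ B * (K * (‖n‖ * (|a| + |b|))) := by
              apply mul_le_mul hx2 (hlip.trans (by gcongr)) (norm_nonneg _) hB0
          _ = C * (|a| + |b|) := by rw [hC]; ring
      have hexp : chartHessian g e ψ x w = chartHessian g e ψ y u +
          fderiv ℝ ψ x (christoffel g e y u u - christoffel g e x w w) := by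
        rw [chartHessian, chartHessian, hww, hdy, map_sub (fderiv ℝ ψ x)]; ring
      simp only
      rw [hexp]
      linarith
  obtain ⟨τ, hτ0, hτ⟩ : ∃ τ > 0, ∀ T, 0 < T → T < τ → C * (T + 1) * T < 1 := by
    -- For `T < 1` the quantity is at most `2 * C * T`, and `2 * (C + 1) * T < 1`.
    refine ⟨min 1 (1 / (2 * (C + 1))), by positivity, fun T hT0 hT => ?_⟩
    have h1 : T < 1 := hT.trans_le (min_le_left _ _)
    have h2 : T < 1 / (2 * (C + 1)) := hT.trans_le (min_le_right _ _)
    rw [lt_div_iff₀ (by positivity)] at h2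
    nlinarith [mul_nonneg hC0 hT0.le]
  refine ⟨_, hineq, τ, hτ0, fun T hT0 hT x w hsol hmem hx0 hw0 => ?_⟩
  have hTmem := right_mem_Icc.2 hT0.le
  refine (hmem T hTmem).2.1 ?_
  have hD0 : fderiv ℝ ψ y₀ (w 0) = 0 := by
    have := (fderiv_of_height hF hψ2 hψ0 hgraph (w 0)).1
    rw [hn, one_mul] at this
    rw [← this, hw0]
  exact nonneg_of_second_deriv_ge (f := fun s => ψ (x s)) (f' := fun s => fderiv ℝ ψ (x s) (w s))
    (f'' := fun s => chartHessian g e ψ (x s) (w s)) hT0.le hC0 (hτ T hT0 hT)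
    (fun s hs => (hsol.hasDerivWithinAt_comp hs (hmem s hs).1).1)
    (fun s hs => (hsol.hasDerivWithinAt_comp hs (hmem s hs).1).2)
    (by simp [hx0, hψ0]) (by simp [hx0, hD0]) (fun s hs => (hmem s hs).2.2)

end Core

/-! ### Tangent vectors of the hypersurface and invariance of the Hessian -/

section Tangent

variable {E : Type*} [NormedAddCommGroup E] [NormedSpace ℝ E]
  {M : Type*} [TopologicalSpace M] [ChartedSpace E M]

lemma contDiffAt_comp_symm {e : OpenPartialHomeomorph M E}
    (he : e ∈ IsManifold.maximalAtlas 𝓘(ℝ, E) 2 M) {φ : M → ℝ} {y : E} (hy : y ∈ e.target)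
    (hφ : ContMDiffAt 𝓘(ℝ, E) 𝓘(ℝ, ℝ) 2 φ (e.symm y)) : ContDiffAt ℝ 2 (φ ∘ e.symm) y := by
  rw [← contMDiffAt_iff_contDiffAt]
  exact hφ.comp y (contMDiffAt_symm_of_mem_maximalAtlas he hy)

lemma mfderiv_eq_fderiv_chartAt {φ : M → ℝ} {q : M}
    (hφ : MDifferentiableAt 𝓘(ℝ, E) 𝓘(ℝ, ℝ) φ q) :
    (mfderiv 𝓘(ℝ, E) 𝓘(ℝ, ℝ) φ q : E →L[ℝ] ℝ) =
      fderiv ℝ (φ ∘ (chartAt E q).symm) (chartAt E q q) := by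
  have h : (mfderiv 𝓘(ℝ, E) 𝓘(ℝ, ℝ) φ q : E →L[ℝ] ℝ) =
      fderivWithin ℝ (writtenInExtChartAt 𝓘(ℝ, E) 𝓘(ℝ, ℝ) q φ) (range 𝓘(ℝ, E))
        (extChartAt 𝓘(ℝ, E) q q) := if_pos hφ
  rw [h]
  simp [writtenInExtChartAt, fderivWithin_univ]
  rfl

lemma fderiv_chartAt_ne_zero {φ : M → ℝ} {q : M}
    (hφ : MDifferentiableAt 𝓘(ℝ, E) 𝓘(ℝ, ℝ) φ q) (h : mfderiv 𝓘(ℝ, E) 𝓘(ℝ, ℝ) φ q ≠ 0) :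
    fderiv ℝ (φ ∘ (chartAt E q).symm) (chartAt E q q) ≠ 0 := by
  rw [← mfderiv_eq_fderiv_chartAt hφ]; exact h

/-- The preferred chart varies with the point, while geodesics are followed in one fixed chart. The
second derivatives of the transition map in the chain rule and in `christoffel_transition` cancel.
-/
lemma hessian_eq_chartHessian [IsManifold 𝓘(ℝ, E) 2 M] [FiniteDimensional ℝ E] (g : Metric E M)
    {e : OpenPartialHomeomorph M E} (he : e ∈ atlas E M) {q : M} (hq : q ∈ e.source) {φ : M → ℝ}
    (hφ : ContMDiffAt 𝓘(ℝ, E) 𝓘(ℝ, ℝ) 2 φ q) (v : TangentSpace 𝓘(ℝ, E) q) :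
    hessian g φ q v v = chartHessian g e (φ ∘ e.symm) (e q)
      (fderiv ℝ (e ∘ (chartAt E q).symm) (chartAt E q q) v) := by
  set c := chartAt E q with hc
  have hcA : c ∈ atlas E M := chart_mem_atlas E q
  have hqc : q ∈ c.source := mem_chart_source E q
  have hy : c q ∈ c.target := c.map_source hqc
  have hcq : c.symm (c q) = q := c.left_inv hqc
  have hy' : c.symm (c q) ∈ e.source := by rwa [hcq]
  have hτ := contDiffAt_transition (IsManifold.subset_maximalAtlas (I := 𝓘(ℝ, E)) (n := 2) hcA)
    (IsManifold.subset_maximalAtlas he) hy hy'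
  have hτq : (e ∘ c.symm) (c q) = e q := by simp [hcq]
  have hF : ContDiffAt ℝ 2 (φ ∘ e.symm) ((e ∘ c.symm) (c q)) := by
    rw [hτq]
    exact contDiffAt_comp_symm (IsManifold.subset_maximalAtlas he) (e.map_source hq)
      (by rwa [e.left_inv hq])
  have heq := comp_symm_eventuallyEq hy hy' φ
  have h1 : fderiv ℝ (φ ∘ c.symm) (c q) =
      (fderiv ℝ (φ ∘ e.symm) ((e ∘ c.symm) (c q))).comp (fderiv ℝ (e ∘ c.symm) (c q)) := by
    rw [heq.fderiv_eq]
    exact fderiv_comp _ (hF.differentiableAt two_ne_zero) (hτ.differentiableAt two_ne_zero)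
  have h2 := fderiv_fderiv_comp hF hτ v v
  rw [← (heq.fderiv (𝕜 := ℝ)).fderiv_eq] at h2
  have h3 := christoffel_transition g hcA he hy hy' v v
  simp only [hessian, coord_eq, ← hc, chartHessian]
  rw [h1, h2, ContinuousLinearMap.comp_apply, h3, hτq, map_add]
  ring

lemma hasVelocityWithin_iff [IsManifold 𝓘(ℝ, E) 1 M] {γ : ℝ → M} {s : Set ℝ} {t : ℝ} {q : M}
    {v : E} : HasVelocityWithin γ s t q v ↔
      γ t = q ∧ ContinuousWithinAt γ s t ∧ HasDerivWithinAt (chartAt E q ∘ γ) v s t := by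
  unfold HasVelocityWithin
  rw [show coord q v = v from coord_eq q v]

lemma HasVelocityWithin.hasDerivWithinAt_comp [IsManifold 𝓘(ℝ, E) 2 M] {γ : ℝ → M} {s : Set ℝ}
    {t : ℝ} {q : M} {v : TangentSpace 𝓘(ℝ, E) q} (h : HasVelocityWithin γ s t q v) {φ : M → ℝ}
    (hφ : ContMDiffAt 𝓘(ℝ, E) 𝓘(ℝ, ℝ) 2 φ q) (hts : t ∈ s) :
    HasDerivWithinAt (φ ∘ γ) (fderiv ℝ (φ ∘ (chartAt E q).symm) (chartAt E q q) v) s t := by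
  obtain ⟨h1, h2, h3⟩ := hasVelocityWithin_iff.1 h
  set c := chartAt E q with hc
  have hqc : q ∈ c.source := mem_chart_source E q
  have hF : ContDiffAt ℝ 2 (φ ∘ c.symm) ((c ∘ γ) t) := by
    have : (c ∘ γ) t = c q := by simp [h1]
    rw [this]
    exact contDiffAt_comp_symm (IsManifold.chart_mem_maximalAtlas q) (c.map_source hqc)
      (by rwa [c.left_inv hqc])
  have h4 := (hF.differentiableAt two_ne_zero).hasFDerivAt.comp_hasDerivWithinAt t h3
  have hqt : (c ∘ γ) t = c q := by simp [h1]
  rw [hqt] at h4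
  refine h4.congr_of_eventuallyEq_of_mem ?_ hts
  have : ∀ᶠ r in 𝓝[s] t, γ r ∈ c.source :=
    h2.eventually_mem (c.open_source.mem_nhds (by rwa [h1]))
  filter_upwards [this] with r hr
  simp [c.left_inv hr]

lemma fderiv_apply_eq_zero_of_mem_tangentSet [IsManifold 𝓘(ℝ, E) 2 M] {H : Set M} {q : M}
    {v : TangentSpace 𝓘(ℝ, E) q} (hv : v ∈ tangentSet (E := E) H q) {φ : M → ℝ}
    (hφ : ContMDiffAt 𝓘(ℝ, E) 𝓘(ℝ, ℝ) 2 φ q) (h0 : ∀ᶠ x in 𝓝 q, x ∈ H → φ x = 0) :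
    fderiv ℝ (φ ∘ (chartAt E q).symm) (chartAt E q q) v = 0 := by
  obtain ⟨γ, hγH, hγ⟩ := hv
  have h1 := hγ.hasDerivWithinAt_comp hφ (mem_univ 0)
  rw [hasDerivWithinAt_univ] at h1
  have hc : ContinuousAt γ 0 := by simpa [continuousWithinAt_univ] using hγ.2.1
  have h2 : φ ∘ γ =ᶠ[𝓝 0] fun _ => 0 := by
    have : ∀ᶠ t in 𝓝 (0 : ℝ), γ t ∈ H → φ (γ t) = 0 :=
      hc.eventually (by rw [hγ.1]; exact h0)
    filter_upwards [this] with t ht using ht (hγH t)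
  exact h1.unique ((hasDerivAt_const (0 : ℝ) (0 : ℝ)).congr_of_eventuallyEq h2)

lemma smul_mem_tangentSet [IsManifold 𝓘(ℝ, E) 2 M] {H : Set M} {q : M} {v : E}
    (hv : v ∈ tangentSet (E := E) H q) (a : ℝ) : a • v ∈ tangentSet (E := E) H q := by
  obtain ⟨γ, hγH, hγ⟩ := hv
  obtain ⟨h1, h2, h3⟩ := hasVelocityWithin_iff.1 hγ
  have hm : HasDerivAt (fun t : ℝ => a * t) a 0 := by
    simpa using (hasDerivAt_id (0 : ℝ)).const_mul a
  refine ⟨fun t => γ (a * t), fun t => hγH _, hasVelocityWithin_iff.2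
    ⟨by simpa using h1, ?_, ?_⟩⟩
  · rw [continuousWithinAt_univ] at h2 ⊢
    exact ContinuousAt.comp (f := fun t : ℝ => a * t) (by simpa using h2) hm.continuousAt
  · rw [hasDerivWithinAt_univ] at h3 ⊢
    exact HasDerivAt.scomp (h := fun t : ℝ => a * t) (0 : ℝ) (by simpa using h3) hm

/-- A vector in the kernel of the differential of a regular defining function is tangent to the
hypersurface. -/
lemma mem_tangentSet_of_fderiv_eq_zero [IsManifold 𝓘(ℝ, E) 2 M] [FiniteDimensional ℝ E]
    {e : OpenPartialHomeomorph M E} (he : e ∈ atlas E M) {H : Set M} {q : M} (hq : q ∈ e.source)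
    (hqH : q ∈ H) {φ : M → ℝ} (hφ : ContMDiffAt 𝓘(ℝ, E) 𝓘(ℝ, ℝ) 2 φ q) (hφq : φ q = 0)
    (h0 : ∀ᶠ x in 𝓝 q, φ x = 0 → x ∈ H) (hd : fderiv ℝ (φ ∘ e.symm) (e q) ≠ 0) {u : E}
    (hu : fderiv ℝ (φ ∘ e.symm) (e q) u = 0) :
    fderiv ℝ (chartAt E q ∘ e.symm) (e q) u ∈ tangentSet (E := E) H q := by
  classical
  have : CompleteSpace E := FiniteDimensional.complete ℝ E
  have hy : e q ∈ e.target := e.map_source hq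
  have heq : e.symm (e q) = q := e.left_inv hq
  have hF : ContDiffAt ℝ 2 (φ ∘ e.symm) (e q) :=
    contDiffAt_comp_symm (IsManifold.subset_maximalAtlas he) hy (by rwa [heq])
  -- The curve sought is the straight line in direction `u`, pushed onto the zero set along `n`. Its
  -- velocity at `0` is still `u`, because the differential of `ψ` vanishes on `u`.
  obtain ⟨n, ψ, hn, -, hψ2, hψ0, hgraph⟩ := exists_height hF (by simp [heq, hφq]) hd
  have hψu : fderiv ℝ ψ (e q) u = 0 := by
    have := (fderiv_of_height hF hψ2 hψ0 hgraph u).1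
    rw [hn, one_mul] at this
    rw [← this, hu]
  let l : ℝ → E := fun t => e q + t • u
  have hl : HasDerivAt l u 0 := by
    have := ((hasDerivAt_id (0 : ℝ)).smul_const u).const_add (e q)
    rwa [one_smul] at this
  have hl0 : l 0 = e q := by simp [l]
  let k : ℝ → E := fun t => l t - ψ (l t) • n
  have hk0 : k 0 = e q := by simp [k, hl0, hψ0]
  have hk : HasDerivAt k u 0 := by
    have h1 : HasDerivAt (fun t => ψ (l t)) (fderiv ℝ ψ (e q) u) 0 :=
      HasFDerivAt.comp_hasDerivAt (0 : ℝ)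
        (by rw [hl0]; exact (hψ2.differentiableAt two_ne_zero).hasFDerivAt) hl
    refine (hl.sub (h1.smul_const n)).congr_deriv ?_
    rw [hψu, zero_smul, sub_zero]
  have hkH : ∀ᶠ t in 𝓝 (0 : ℝ), e.symm (k t) ∈ H := by
    have h1 : ∀ᶠ t in 𝓝 (0 : ℝ), (φ ∘ e.symm) (k t) = 0 :=
      hl.continuousAt.eventually (by rw [hl0]; exact hgraph)
    have h2 : ContinuousAt (fun t => e.symm (k t)) 0 :=
      ContinuousAt.comp (f := k) (by rw [hk0]; exact e.continuousAt_symm hy) hk.continuousAt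
    have h3 : ∀ᶠ t in 𝓝 (0 : ℝ), φ (e.symm (k t)) = 0 → e.symm (k t) ∈ H :=
      h2.eventually (by simpa only [hk0, heq] using h0)
    filter_upwards [h1, h3] with t ht1 ht2 using ht2 ht1
  -- `tangentSet` asks for a curve in `H` at all times, so the curve is replaced by the constant `q`
  -- where it is not in `H`; nothing changes near `0`.
  let γ : ℝ → M := fun t => if e.symm (k t) ∈ H then e.symm (k t) else q
  have hγ : γ =ᶠ[𝓝 0] fun t => e.symm (k t) := by
    filter_upwards [hkH] with t ht using if_pos ht
  have hγ0 : γ 0 = q := by simp [γ, hk0, heq]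
  refine ⟨γ, fun t => ?_, hasVelocityWithin_iff.2 ⟨hγ0, ?_, ?_⟩⟩
  · by_cases ht : e.symm (k t) ∈ H
    · simp only [γ, if_pos ht, ht]
    · simp only [γ, if_neg ht, hqH]
  · rw [continuousWithinAt_univ]
    refine ContinuousAt.congr ?_ hγ.symm
    exact ContinuousAt.comp (f := k) (by rw [hk0]; exact e.continuousAt_symm hy) hk.continuousAt
  · rw [hasDerivWithinAt_univ]
    have hτ := contDiffAt_transition (IsManifold.subset_maximalAtlas (I := 𝓘(ℝ, E)) (n := 2) he)
      (IsManifold.chart_mem_maximalAtlas q) hy (by rw [heq]; exact mem_chart_source E q)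
    have h1 : HasDerivAt (fun t => (chartAt E q ∘ e.symm) (k t))
        (fderiv ℝ (chartAt E q ∘ e.symm) (e q) u) 0 :=
      HasFDerivAt.comp_hasDerivAt (0 : ℝ)
        (by rw [hk0]; exact (hτ.differentiableAt two_ne_zero).hasFDerivAt) hk
    exact h1.congr_of_eventuallyEq (hγ.fun_comp _)

lemma fderiv_transition_fderiv_transition [IsManifold 𝓘(ℝ, E) 2 M]
    {e e' : OpenPartialHomeomorph M E} (he : e ∈ atlas E M) (he' : e' ∈ atlas E M) {q : M}
    (hq : q ∈ e.source) (hq' : q ∈ e'.source) (u : E) :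
    fderiv ℝ (e ∘ e'.symm) (e' q) (fderiv ℝ (e' ∘ e.symm) (e q) u) = u := by
  have hy : e q ∈ e.target := e.map_source hq
  have hy' : e' q ∈ e'.target := e'.map_source hq'
  have hτ := contDiffAt_transition (IsManifold.subset_maximalAtlas (I := 𝓘(ℝ, E)) (n := 2) he)
    (IsManifold.subset_maximalAtlas he') hy (by rwa [e.left_inv hq])
  have hτ' := contDiffAt_transition (IsManifold.subset_maximalAtlas (I := 𝓘(ℝ, E)) (n := 2) he')
    (IsManifold.subset_maximalAtlas he) hy' (by rwa [e'.left_inv hq'])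
  have h0 : (e' ∘ e.symm) (e q) = e' q := by simp [e.left_inv hq]
  have h1 : (e ∘ e'.symm) ∘ (e' ∘ e.symm) =ᶠ[𝓝 (e q)] id := by
    filter_upwards [eventually_transition hy (by rwa [e.left_inv hq] : e.symm (e q) ∈ e'.source)]
      with z hz
    simp [e'.left_inv hz.2, e.right_inv hz.1]
  have h2 : HasFDerivAt ((e ∘ e'.symm) ∘ (e' ∘ e.symm)) _ (e q) :=
    HasFDerivAt.comp (e q) (by rw [h0]; exact (hτ'.differentiableAt two_ne_zero).hasFDerivAt)
      (hτ.differentiableAt two_ne_zero).hasFDerivAt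
  have h3 := (hasFDerivAt_id (𝕜 := ℝ) (e q)).congr_of_eventuallyEq h1
  exact congrArg (fun L : E →L[ℝ] E => L u) (h2.unique h3)

end Tangent

/-! ### The two sides of a hypersurface -/

section Sides

variable {E : Type*} [NormedAddCommGroup E] [NormedSpace ℝ E]
  {M : Type*} [TopologicalSpace M] [ChartedSpace E M]

lemma eventually_pos_of_hasDerivAt {f : ℝ → ℝ} {c : ℝ} (h : HasDerivAt f c 0) (h0 : f 0 = 0)
    (hc : 0 < c) : ∀ᶠ t in 𝓝[>] (0 : ℝ), 0 < f t := by
  have h1 := (hasDerivAt_iff_tendsto_slope.1 h).mono_left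
    (nhdsWithin_mono (0 : ℝ) (fun t (ht : 0 < t) => ht.ne' : Ioi (0 : ℝ) ⊆ {0}ᶜ))
  filter_upwards [h1.eventually (lt_mem_nhds hc), self_mem_nhdsWithin] with t ht (ht0 : 0 < t)
  rw [slope_def_field, h0, sub_zero, sub_zero] at ht
  exact (div_pos_iff_of_pos_right ht0).1 ht

lemma mfderiv_comp_chart_ne_zero [IsManifold 𝓘(ℝ, E) 2 M] {e : OpenPartialHomeomorph M E}
    (he : e ∈ IsManifold.maximalAtlas 𝓘(ℝ, E) 2 M) {x : M} (hx : x ∈ e.source) {l : E →L[ℝ] ℝ}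
    (hl : l ≠ 0) : mfderiv 𝓘(ℝ, E) 𝓘(ℝ, ℝ) (l ∘ e) x ≠ 0 := by
  have hm : e.MDifferentiable 𝓘(ℝ, E) 𝓘(ℝ, E) :=
    ⟨fun y hy => ((contMDiffAt_of_mem_maximalAtlas he hy).mdifferentiableAt
      two_ne_zero).mdifferentiableWithinAt,
    fun y hy => ((contMDiffAt_symm_of_mem_maximalAtlas he hy).mdifferentiableAt
      two_ne_zero).mdifferentiableWithinAt⟩
  obtain ⟨m, hm0⟩ : ∃ m, l m ≠ 0 := by
    by_contra! h; exact hl (ContinuousLinearMap.ext h)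
  obtain ⟨v, hv⟩ := hm.mfderiv_surjective hx m
  intro h
  apply hm0
  have h1 := (l.hasMFDerivAt.comp x (hm.mdifferentiableAt hx).hasMFDerivAt).mfderiv
  rw [h] at h1
  have h2 := congrArg (fun L : E →L[ℝ] ℝ => L v) h1
  rw [← hv]
  exact h2.symm

/-- Near a point of `H` that is in the closure of both sides, the sides are the half balls of a
chart that straightens `H`. -/
lemma exists_side_nhds [IsManifold 𝓘(ℝ, E) 2 M] {H : Set M} (hH : IsHypersurface E H) {q : M}
    (hq : q ∈ H) {W A B : Set M} (hW : IsOpen W) (hqW : q ∈ W) (hA : IsOpen A) (hB : IsOpen B)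
    (hAB : Disjoint A B) (hcov : A ∪ B = W \ H) (hqA : q ∈ closure A) (hqB : q ∈ closure B) :
    ∃ (N : Set M) (F : M → ℝ), IsOpen N ∧ q ∈ N ∧ N ⊆ W ∧
      ContMDiffOn 𝓘(ℝ, E) 𝓘(ℝ, ℝ) 2 F N ∧
      (∀ x ∈ N, (0 < F x ↔ x ∈ A) ∧ (F x < 0 ↔ x ∈ B) ∧ (F x = 0 ↔ x ∈ H) ∧
        mfderiv 𝓘(ℝ, E) 𝓘(ℝ, ℝ) F x ≠ 0) ∧
      IsPreconnected (N ∩ A) ∧ IsPreconnected (N ∩ B) := by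
  obtain ⟨e, he, hqe, ℓ, hℓ, hHℓ⟩ := hH q hq
  have hS : e.target ∩ e.symm ⁻¹' W ∈ 𝓝 (e q) := by
    refine Filter.inter_mem (e.open_target.mem_nhds (e.map_source hqe)) ?_
    refine (e.continuousAt_symm (e.map_source hqe)).preimage_mem_nhds ?_
    rw [e.left_inv hqe]; exact hW.mem_nhds hqW
  obtain ⟨r, hr, hball⟩ := Metric.mem_nhds_iff.1 hS
  set N := e.source ∩ e ⁻¹' Metric.ball (e q) r with hN
  have hNo : IsOpen N := e.isOpen_inter_preimage Metric.isOpen_ball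
  have hqN : q ∈ N := ⟨hqe, Metric.mem_ball_self hr⟩
  have hNW : N ⊆ W := fun x hx => by
    have := (hball hx.2).2
    rwa [mem_preimage, e.left_inv hx.1] at this
  -- In the straightening chart a half ball is convex, hence connected, and so lies entirely in `A`
  -- or entirely in `B`.
  have half : ∀ l : E →L[ℝ] ℝ, IsPreconnected (N ∩ {x | 0 < l (e x)}) := by
    intro l
    have h1 : IsPreconnected (Metric.ball (e q) r ∩ {y | 0 < l y}) :=
      ((convex_ball _ _).inter (convex_halfSpace_gt l.isLinear 0)).isPreconnected
    have h2 : N ∩ {x | 0 < l (e x)} = e.symm '' (Metric.ball (e q) r ∩ {y | 0 < l y}) := by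
      ext x
      constructor
      · rintro ⟨⟨hx1, hx2⟩, hx3⟩
        exact ⟨e x, ⟨hx2, hx3⟩, e.left_inv hx1⟩
      · rintro ⟨y, ⟨hy1, hy2⟩, rfl⟩
        have hyt := (hball hy1).1
        refine ⟨⟨e.map_target hyt, ?_⟩, ?_⟩
        · rwa [mem_preimage, e.right_inv hyt]
        · rwa [mem_ofPred_eq, e.right_inv hyt]
    rw [h2]
    exact h1.image _ (e.continuousOn_symm.mono fun y hy => (hball hy.1).1)
  have main : ∀ l : E →L[ℝ] ℝ, l ≠ 0 → (∀ x ∈ e.source, x ∈ H ↔ l (e x) = 0) →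
      N ∩ {x | 0 < l (e x)} ⊆ A → N ∩ {x | 0 < (-l) (e x)} ⊆ B →
      ∃ (N : Set M) (F : M → ℝ), IsOpen N ∧ q ∈ N ∧ N ⊆ W ∧
      ContMDiffOn 𝓘(ℝ, E) 𝓘(ℝ, ℝ) 2 F N ∧
      (∀ x ∈ N, (0 < F x ↔ x ∈ A) ∧ (F x < 0 ↔ x ∈ B) ∧ (F x = 0 ↔ x ∈ H) ∧
        mfderiv 𝓘(ℝ, E) 𝓘(ℝ, ℝ) F x ≠ 0) ∧
      IsPreconnected (N ∩ A) ∧ IsPreconnected (N ∩ B) := by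
    intro l hl hHl hlA hlB
    have hAH : ∀ x ∈ A, x ∉ H := fun x hx => (hcov.subset (Or.inl hx)).2
    have hBH : ∀ x ∈ B, x ∉ H := fun x hx => (hcov.subset (Or.inr hx)).2
    have hd : ∀ x ∈ A, x ∉ B := fun x hx hx' => disjoint_left.1 hAB hx hx'
    have hlB' : ∀ x ∈ N, l (e x) < 0 → x ∈ B := fun x hx h =>
      hlB ⟨hx, by simpa using h⟩
    have hposA : ∀ x ∈ N, (0 < l (e x) ↔ x ∈ A) := fun x hx => by
      refine ⟨fun h => hlA ⟨hx, h⟩, fun hxA => ?_⟩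
      rcases lt_trichotomy (l (e x)) 0 with h | h | h
      · exact absurd (hlB' x hx h) (hd x hxA)
      · exact absurd ((hHl x hx.1).2 h) (hAH x hxA)
      · exact h
    have hnegB : ∀ x ∈ N, (l (e x) < 0 ↔ x ∈ B) := fun x hx => by
      refine ⟨fun h => hlB' x hx h, fun hxB => ?_⟩
      rcases lt_trichotomy (l (e x)) 0 with h | h | h
      · exact h
      · exact absurd ((hHl x hx.1).2 h) (hBH x hxB)
      · exact absurd hxB (hd x (hlA ⟨hx, h⟩))
    refine ⟨N, l ∘ e, hNo, hqN, hNW, ?_, fun x hx => ⟨hposA x hx, hnegB x hx,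
      (hHl x hx.1).symm, mfderiv_comp_chart_ne_zero he hx.1 hl⟩, ?_, ?_⟩
    · exact l.contMDiff.comp_contMDiffOn
        ((contMDiffOn_of_mem_maximalAtlas he).mono inter_subset_left)
    · have : N ∩ A = N ∩ {x | 0 < l (e x)} := by
        ext x; exact and_congr_right fun hx => (hposA x hx).symm
      rw [this]; exact half l
    · have : N ∩ B = N ∩ {x | 0 < (-l) (e x)} := by
        ext x
        refine and_congr_right fun hx => ((hnegB x hx).symm.trans ?_)
        simp
      rw [this]; exact half (-l)
  have hsub : ∀ l : E →L[ℝ] ℝ, (∀ x ∈ e.source, x ∈ H ↔ l (e x) = 0) →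
      N ∩ {x | 0 < l (e x)} ⊆ A ∪ B := fun l hHl x hx => by
    rw [hcov]
    exact ⟨hNW hx.1, fun hxH => hx.2.ne' ((hHl x hx.1.1).1 hxH)⟩
  have hHℓ' : ∀ x ∈ e.source, x ∈ H ↔ (-ℓ) (e x) = 0 := fun x hx => by
    rw [hHℓ x hx]; simp
  have hNAB : N ∩ (A ∪ B) ⊆ (N ∩ {x | 0 < ℓ (e x)}) ∪ (N ∩ {x | 0 < (-ℓ) (e x)}) := by
    intro x hx
    have hxH : x ∉ H := (hcov.subset hx.2).2
    rcases lt_trichotomy (ℓ (e x)) 0 with h | h | h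
    · exact Or.inr ⟨hx.1, by simpa using h⟩
    · exact absurd ((hHℓ x hx.1.1).2 h) hxH
    · exact Or.inl ⟨hx.1, h⟩
  have hne : ∀ {S : Set M}, q ∈ closure S → (N ∩ S).Nonempty := fun hqS =>
    mem_closure_iff.1 hqS N hNo hqN
  -- Both halves on the same side is impossible, since `q` is in the closure of the other side too.
  -- The remaining two cases differ by the sign of `ℓ`.
  rcases (half ℓ).subset_or_subset hA hB hAB (hsub ℓ hHℓ) with h1 | h1 <;>
    rcases (half (-ℓ)).subset_or_subset hA hB hAB (hsub (-ℓ) hHℓ') with h2 | h2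
  · obtain ⟨x, hxN, hxB⟩ := hne hqB
    rcases hNAB ⟨hxN, Or.inr hxB⟩ with h | h
    · exact absurd hxB (disjoint_left.1 hAB (h1 h))
    · exact absurd hxB (disjoint_left.1 hAB (h2 h))
  · exact main ℓ hℓ hHℓ h1 h2
  · exact main (-ℓ) (neg_ne_zero.2 hℓ) hHℓ' h2 (by rwa [neg_neg])
  · obtain ⟨x, hxN, hxA⟩ := hne hqA
    rcases hNAB ⟨hxN, Or.inl hxA⟩ with h | h
    · exact absurd (h1 h) (disjoint_left.1 hAB hxA)
    · exact absurd (h2 h) (disjoint_left.1 hAB hxA)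

/-- A union of preconnected pieces `N q ∩ A`, indexed by a preconnected subset of the closure
of `A`. -/
lemma isPreconnected_biUnion_inter {X : Type*} [TopologicalSpace X] {U A : Set X}
    {N : X → Set X} (hU : IsPreconnected U) (hN : ∀ q ∈ U, IsOpen (N q)) (hqN : ∀ q ∈ U, q ∈ N q)
    (hUA : U ⊆ closure A) (hNA : ∀ q ∈ U, IsPreconnected (N q ∩ A)) :
    IsPreconnected (⋃ q ∈ U, N q ∩ A) := by
  refine IsPreconnected.biUnion_of_reflTransGen hNA fun i hi j hj => ?_
  -- For nearby points `x`, `y` of `U`, the open set `N x ∩ N y` contains `y` and therefore meets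
  -- `A`. Connectedness of `U` links any two pieces by a finite chain.
  refine hU.induction₂' (fun i j => Relation.ReflTransGen
    (fun i j => ((N i ∩ A) ∩ (N j ∩ A)).Nonempty ∧ i ∈ U) i j) (fun x hx => ?_)
    (fun x y z _ _ _ h1 h2 => h1.trans h2) hi hj
  filter_upwards [self_mem_nhdsWithin, mem_nhdsWithin_of_mem_nhds ((hN x hx).mem_nhds (hqN x hx))]
    with y hy hyN
  obtain ⟨z, ⟨hz1, hz2⟩, hz3⟩ := mem_closure_iff.1 (hUA hy) (N x ∩ N y)
    ((hN x hx).inter (hN y hy)) ⟨hyN, hqN y hy⟩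
  exact ⟨Relation.ReflTransGen.single ⟨⟨z, ⟨hz1, hz3⟩, hz2, hz3⟩, hx⟩,
    Relation.ReflTransGen.single ⟨⟨z, ⟨hz2, hz3⟩, hz1, hz3⟩, hy⟩⟩

/-- A regular zero of a function is in the closure of the set where the function is positive. -/
lemma mem_closure_pos [IsManifold 𝓘(ℝ, E) 2 M] {V : Set M} (hV : IsOpen V) {φ : M → ℝ} {q : M}
    (hqV : q ∈ V) (hφ : ContMDiffAt 𝓘(ℝ, E) 𝓘(ℝ, ℝ) 2 φ q) (h0 : φ q = 0)
    (hd : fderiv ℝ (φ ∘ (chartAt E q).symm) (chartAt E q q) ≠ 0) :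
    q ∈ closure {x ∈ V | 0 < φ x} := by
  set c := chartAt E q with hc
  have hqc : q ∈ c.source := mem_chart_source E q
  have hcq : c.symm (c q) = q := c.left_inv hqc
  have hF : ContDiffAt ℝ 2 (φ ∘ c.symm) (c q) :=
    contDiffAt_comp_symm (IsManifold.chart_mem_maximalAtlas q) (c.map_source hqc) (by rwa [hcq])
  obtain ⟨m, hm⟩ : ∃ m, 0 < fderiv ℝ (φ ∘ c.symm) (c q) m := by
    by_contra! h
    refine hd (ContinuousLinearMap.ext fun m => le_antisymm (h m) ?_)
    have := h (-m)
    rw [map_neg] at this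
    simpa using this
  let l : ℝ → E := fun t => c q + t • m
  have hl : HasDerivAt l m 0 := by
    have := ((hasDerivAt_id (0 : ℝ)).smul_const m).const_add (c q)
    rwa [one_smul] at this
  have hl0 : l 0 = c q := by simp [l]
  have h1 : HasDerivAt (fun t => (φ ∘ c.symm) (l t)) (fderiv ℝ (φ ∘ c.symm) (c q) m) 0 :=
    HasFDerivAt.comp_hasDerivAt (0 : ℝ)
      (by rw [hl0]; exact (hF.differentiableAt two_ne_zero).hasFDerivAt) hl
  have h2 := eventually_pos_of_hasDerivAt h1 (by simp [hl0, hcq, h0]) hm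
  have h3 : Filter.Tendsto (fun t => c.symm (l t)) (𝓝 0) (𝓝 q) := by
    have : ContinuousAt (fun t => c.symm (l t)) 0 :=
      ContinuousAt.comp (f := l) (by rw [hl0]; exact c.continuousAt_symm (c.map_source hqc))
        hl.continuousAt
    simpa only [ContinuousAt, hl0, hcq] using this
  have h4 := h3.mono_left (nhdsWithin_le_nhds (s := Ioi 0))
  refine mem_closure_of_tendsto h4 ?_
  filter_upwards [h2, h4.eventually (hV.mem_nhds hqV)] with t ht ht' using ⟨ht', ht⟩

end Sides

/-! ### Change of sign of the defining function -/

section Neg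

variable {E : Type*} [NormedAddCommGroup E] [NormedSpace ℝ E]
  {M : Type*} [TopologicalSpace M] [ChartedSpace E M]

lemma mfderiv_neg_ne_zero {φ : M → ℝ} {q : M} (h : mfderiv 𝓘(ℝ, E) 𝓘(ℝ, ℝ) φ q ≠ 0) :
    mfderiv 𝓘(ℝ, E) 𝓘(ℝ, ℝ) (-φ) q ≠ 0 := by
  rw [mfderiv_neg]
  exact neg_ne_zero.2 h

lemma hessian_neg (g : Metric E M) (φ : M → ℝ) (q : M) (u v : TangentSpace 𝓘(ℝ, E) q) :
    hessian g (-φ) q u v = -hessian g φ q u v := by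
  have h0 : (-φ) ∘ (chartAt E q).symm = -(φ ∘ (chartAt E q).symm) := rfl
  have h1 : fderiv ℝ (-(φ ∘ (chartAt E q).symm)) = -fderiv ℝ (φ ∘ (chartAt E q).symm) := by
    ext y : 1
    exact fderiv_neg
  simp only [hessian, h0, h1, fderiv_neg]
  simp only [neg_apply]
  ring

end Neg

/-! ### Infinitesimal convexity implies local convexity -/

section InfinitesimalToLocal

variable {E : Type*} [NormedAddCommGroup E] [NormedSpace ℝ E] [FiniteDimensional ℝ E]
  {M : Type*} [TopologicalSpace M] [ChartedSpace E M] [IsManifold 𝓘(ℝ, E) 2 M]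

lemma IsChartSolution.hasVelocityWithin {g : Metric E M} {q : M} {x w : ℝ → E}
    (h : IsChartSolution g (chartAt E q) x w (Icc 0 1)) (hx0 : x 0 = chartAt E q q) :
    HasVelocityWithin ((chartAt E q).symm ∘ x) (Icc 0 1) 0 q (w 0) := by
  have h01 : (0 : ℝ) ∈ Icc (0 : ℝ) 1 := left_mem_Icc.2 zero_le_one
  refine hasVelocityWithin_iff.2 ⟨?_, ?_, ?_⟩
  · simp [hx0]
  · exact (h.isGeodesicOn (chart_mem_atlas E q)).1 0 h01
  · exact (h 0 h01).2.1.congr_of_mem (fun t ht => (chartAt E q).right_inv (h t ht).1) h01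

/-- The set `V'` allows the endpoint to be kept in the smaller open set on which the sides are
connected. -/
lemma exists_isExp_nonneg (g : Metric E M) {H V : Set M} {φ : M → ℝ} (hV : IsOpen V)
    (hφ : ContMDiffOn 𝓘(ℝ, E) 𝓘(ℝ, ℝ) 2 φ V) (hVH : ∀ x ∈ V, φ x = 0 ↔ x ∈ H)
    (hess : ∀ q ∈ V, φ q = 0 → ∀ v ∈ tangentSet (E := E) H q, 0 ≤ hessian g φ q v v)
    {q : M} (hqV : q ∈ V) (hq0 : φ q = 0) (hd : mfderiv 𝓘(ℝ, E) 𝓘(ℝ, ℝ) φ q ≠ 0)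
    {V' : Set M} (hV' : V' ∈ 𝓝 q) :
    ∃ O ∈ 𝓝 (0 : E), ∀ v ∈ O, v ∈ tangentSet (E := E) H q →
      ∃ x ∈ V', 0 ≤ φ x ∧ IsExp g q v x := by
  set c := chartAt E q with hc
  have hcA : c ∈ atlas E M := chart_mem_atlas E q
  have hcM : c ∈ IsManifold.maximalAtlas 𝓘(ℝ, E) 2 M := IsManifold.chart_mem_maximalAtlas q
  have hqc : q ∈ c.source := mem_chart_source E q
  have hy₀ : c q ∈ c.target := c.map_source hqc
  have hcq : c.symm (c q) = q := c.left_inv hqc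
  have hφat : ∀ x ∈ V, ContMDiffAt 𝓘(ℝ, E) 𝓘(ℝ, ℝ) 2 φ x := fun x hx =>
    hφ.contMDiffAt (hV.mem_nhds hx)
  have hF : ContDiffAt ℝ 2 (φ ∘ c.symm) (c q) :=
    contDiffAt_comp_symm hcM hy₀ (by rw [hcq]; exact hφat q hqV)
  have hdF : fderiv ℝ (φ ∘ c.symm) (c q) ≠ 0 :=
    fderiv_chartAt_ne_zero ((hφat q hqV).mdifferentiableAt two_ne_zero) hd
  have hsymm : Filter.Tendsto c.symm (𝓝 (c q)) (𝓝 q) := by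
    have := c.continuousAt_symm hy₀
    rwa [ContinuousAt, hcq] at this
  -- Each vector in the kernel of the differential at a nearby zero is the velocity of a curve in
  -- `H`, so the Hessian condition at all points of `H` near `q` can be read in the one chart `c`.
  have hconv : ∀ᶠ y in 𝓝 (c q), (φ ∘ c.symm) y = 0 → ∀ u, fderiv ℝ (φ ∘ c.symm) y u = 0 →
      0 ≤ chartHessian g c (φ ∘ c.symm) y u := by
    have h1 : ∀ᶠ y in 𝓝 (c q), fderiv ℝ (φ ∘ c.symm) y ≠ 0 :=
      (hF.fderiv_right (m := 1) (by norm_num)).continuousAt.eventually_ne hdF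
    filter_upwards [h1, hsymm.eventually (hV.mem_nhds hqV), c.open_target.mem_nhds hy₀]
      with y hy1 hyV hyt hy0 u hu
    set p := c.symm y with hp
    have hpy : c p = y := c.right_inv hyt
    have hpc : p ∈ c.source := c.map_target hyt
    rw [← hpy] at hu hy1 ⊢
    have hv := mem_tangentSet_of_fderiv_eq_zero hcA hpc ((hVH p hyV).1 hy0) (hφat p hyV) hy0
      (by filter_upwards [hV.mem_nhds hyV] with x hx using (hVH x hx).1) hy1 hu
    have h2 := hess p hyV hy0 _ hv
    have h3 := h2.trans_eq (hessian_eq_chartHessian g hcA hpc (hφat p hyV) _)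
    rwa [fderiv_transition_fderiv_transition hcA (chart_mem_atlas E p) hpc
      (mem_chart_source E p)] at h3
  obtain ⟨N, hN, τ, hτ, hcore⟩ := exists_nhds_forall_nonneg g hcA hy₀ hF (by simp [hcq, hq0]) hdF
    hconv
  have hN' : N ∩ Prod.fst ⁻¹' (c.symm ⁻¹' V') ∈ 𝓝 (c q, (0 : E)) :=
    Filter.inter_mem hN (continuousAt_fst.preimage_mem_nhds (hsymm hV'))
  obtain ⟨T, hT0, hTτ, r, hr, hsol⟩ := exists_isChartSolution g hcA hy₀ hN' hτ
  -- Run for time `T` with initial velocity `T⁻¹ • v`, of norm at most `r`; rescaled to `[0, 1]`,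
  -- this is the geodesic with initial velocity `v`.
  refine ⟨Metric.ball 0 (T * r), Metric.ball_mem_nhds _ (by positivity), fun v hv hvH => ?_⟩
  obtain ⟨x, w, hx0, hw0, hxw, hmem⟩ := hsol (T⁻¹ • v) (by
    rw [mem_ball_zero_iff] at hv
    rw [norm_smul, norm_inv, Real.norm_eq_abs, abs_of_pos hT0, inv_mul_le_iff₀ hT0]
    exact hv.le)
  have hdv : fderiv ℝ (φ ∘ c.symm) (c q) v = 0 :=
    fderiv_apply_eq_zero_of_mem_tangentSet hvH (hφat q hqV)
      (by filter_upwards [hV.mem_nhds hqV] with x hx using (hVH x hx).2)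
  have hnn : 0 ≤ (φ ∘ c.symm) (x T) := hcore T hT0 hTτ x w hxw (fun t ht => (hmem t ht).1) hx0
    (by rw [hw0, map_smul, hdv, smul_zero])
  have hres := hxw.rescale hT0.le le_rfl
  have hvel := hres.hasVelocityWithin (by simp [hx0, hc])
  have hv' : T • w (T * 0) = v := by rw [mul_zero, hw0, smul_inv_smul₀ hT0.ne']
  rw [hv'] at hvel
  refine ⟨c.symm (x T), (hmem T (right_mem_Icc.2 hT0.le)).2, hnn,
    c.symm ∘ fun t => x (T * t), hres.isGeodesicOn hcA, hvel, by simp⟩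

/-- Infinitesimal convexity implies local convexity, when the Hessian is nonnegative. -/
lemma locallyConvexIn_of_hessian_nonneg (g : Metric E M) {H U V : Set M} (hH : IsHypersurface E H)
    {φ : M → ℝ} (hV : IsOpen V) (hφ : ContMDiffOn 𝓘(ℝ, E) 𝓘(ℝ, ℝ) 2 φ V) (hVH : V ∩ H = U)
    (hVφ : {x ∈ V | φ x = 0} = U) (hd : ∀ x ∈ U, mfderiv 𝓘(ℝ, E) 𝓘(ℝ, ℝ) φ x ≠ 0)
    (hess : ∀ q ∈ U, ∀ v ∈ tangentSet (E := E) H q, 0 ≤ hessian g φ q v v) :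
    LocallyConvexIn g H U := by
  have hiff : ∀ x ∈ V, φ x = 0 ↔ x ∈ H := fun x hx =>
    ⟨fun h => (hVH.symm.subset (hVφ.subset ⟨hx, h⟩)).2,
      fun h => (hVφ.symm.subset (hVH.subset ⟨hx, h⟩)).2⟩
  have hUV : ∀ x ∈ U, x ∈ V := fun x hx => (hVH.symm.subset hx).1
  have hUH : ∀ x ∈ U, x ∈ H := fun x hx => (hVH.symm.subset hx).2
  have hU0 : ∀ x ∈ U, φ x = 0 := fun x hx => (hVφ.symm.subset hx).2
  have hφat : ∀ x ∈ V, ContMDiffAt 𝓘(ℝ, E) 𝓘(ℝ, ℝ) 2 φ x := fun x hx =>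
    hφ.contMDiffAt (hV.mem_nhds hx)
  set P := {x ∈ V | 0 < φ x} with hP
  set Q := {x ∈ V | φ x < 0} with hQ
  have hPo : IsOpen P := hφ.continuousOn.isOpen_inter_preimage hV isOpen_Ioi
  have hQo : IsOpen Q := hφ.continuousOn.isOpen_inter_preimage hV isOpen_Iio
  have hPQ : Disjoint P Q := disjoint_left.2 fun x hx hx' => lt_asymm hx.2 hx'.2
  have hcov : P ∪ Q = V \ H := by
    ext x
    constructor
    · rintro (⟨hxV, hx⟩ | ⟨hxV, hx⟩)
      · exact ⟨hxV, fun h => hx.ne' ((hiff x hxV).2 h)⟩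
      · exact ⟨hxV, fun h => hx.ne ((hiff x hxV).2 h)⟩
    · rintro ⟨hxV, hx⟩
      rcases lt_trichotomy (φ x) 0 with h | h | h
      · exact Or.inr ⟨hxV, h⟩
      · exact absurd ((hiff x hxV).1 h) hx
      · exact Or.inl ⟨hxV, h⟩
  have hUP : U ⊆ closure P := fun x hx =>
    mem_closure_pos hV (hUV x hx) (hφat x (hUV x hx)) (hU0 x hx)
      (fderiv_chartAt_ne_zero ((hφat x (hUV x hx)).mdifferentiableAt two_ne_zero) (hd x hx))
  have hUQ : U ⊆ closure Q := fun x hx => by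
    have h1 : ContMDiffAt 𝓘(ℝ, E) 𝓘(ℝ, ℝ) 2 (-φ) x := (hφat x (hUV x hx)).neg
    have := mem_closure_pos hV (hUV x hx) h1 (by simp [hU0 x hx])
      (fderiv_chartAt_ne_zero (h1.mdifferentiableAt two_ne_zero) (mfderiv_neg_ne_zero (hd x hx)))
    simpa using this
  have hloc : ∀ q : M, ∃ N : Set M, q ∈ U → IsOpen N ∧ q ∈ N ∧ N ⊆ V ∧
      IsPreconnected (N ∩ P) ∧ IsPreconnected (N ∩ Q) := by
    intro q
    by_cases hq : q ∈ U
    · obtain ⟨N, F, h1, h2, h3, -, -, h4, h5⟩ := exists_side_nhds hH (hUH q hq) hV (hUV q hq) hPo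
        hQo hPQ hcov (hUP hq) (hUQ hq)
      exact ⟨N, fun _ => ⟨h1, h2, h3, h4, h5⟩⟩
    · exact ⟨∅, fun h => absurd h hq⟩
  choose N hN using hloc
  -- The sets where `φ` is positive or negative in `V` need not be connected, even if `U` is; far
  -- components are discarded by passing to `V'`.
  set V' := ⋃ q ∈ U, N q with hV'
  have hV'o : IsOpen V' := isOpen_biUnion fun q hq => (hN q hq).1
  have hV'V : V' ⊆ V := iUnion₂_subset fun q hq => (hN q hq).2.2.1
  have hUV' : U ⊆ V' := fun q hq => mem_biUnion hq (hN q hq).2.1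
  have hV'H : V' ∩ H = U := by
    refine Subset.antisymm (fun x hx => hVH.subset ⟨hV'V hx.1, hx.2⟩) fun x hx =>
      ⟨hUV' hx, hUH x hx⟩
  have hclP : V' ∩ H ⊆ closure (V' ∩ P) := fun x hx =>
    hV'o.inter_closure ⟨hx.1, hUP (hV'H.subset hx)⟩
  have hclQ : V' ∩ H ⊆ closure (V' ∩ Q) := fun x hx =>
    hV'o.inter_closure ⟨hx.1, hUQ (hV'H.subset hx)⟩
  refine ⟨V', V' ∩ P, V' ∩ Q, hV'o, hV'H, ⟨hV'o.inter hPo, hV'o.inter hQo,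
    hPQ.mono inter_subset_right inter_subset_right, ?_, hclP, hclQ, ?_⟩, fun q hq => ?_⟩
  · rw [← inter_union_distrib_left, hcov, ← inter_sdiff_assoc, inter_eq_left.2 hV'V]
  · rintro ⟨hne, hconn⟩
    rw [hV'H] at hconn
    have hcon : ∀ R, U ⊆ closure R → (∀ q ∈ U, IsPreconnected (N q ∩ R)) →
        V' ∩ H ⊆ closure (V' ∩ R) → IsConnected (V' ∩ R) := by
      intro R hUR hNR hcl
      refine ⟨closure_nonempty_iff.1 (hne.mono hcl), ?_⟩
      rw [hV', iUnion₂_inter]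
      exact isPreconnected_biUnion_inter hconn (fun q hq => (hN q hq).1)
        (fun q hq => (hN q hq).2.1) hUR hNR
    exact ⟨hcon P hUP (fun q hq => (hN q hq).2.2.2.1) hclP,
      hcon Q hUQ (fun q hq => (hN q hq).2.2.2.2) hclQ⟩
  · obtain ⟨O, hO, hexp⟩ := exists_isExp_nonneg g hV hφ hiff
      (fun p hp hp0 => hess p (hVφ.subset ⟨hp, hp0⟩)) (hUV q hq) (hU0 q hq) (hd q hq)
      (hV'o.mem_nhds (hUV' hq))
    refine ⟨O, hO, fun v hv hvH => ?_⟩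
    obtain ⟨x, hxV', hx0, hx⟩ := hexp v hv hvH
    refine ⟨x, ?_, hx⟩
    rcases hx0.eq_or_lt with h | h
    · exact hclP ⟨hxV', (hiff x (hV'V hxV')).1 h.symm⟩
    · exact subset_closure ⟨hxV', hV'V hxV', h⟩

theorem InfinitesimallyConvexIn.locallyConvexIn {g : Metric E M} {H U : Set M}
    (hH : IsHypersurface E H) (h : InfinitesimallyConvexIn g H U) : LocallyConvexIn g H U := by
  obtain ⟨V, φ, hV, hφ, hVH, hVφ, hd, hess | hess⟩ := h
  · refine locallyConvexIn_of_hessian_nonneg g hH hV (φ := -φ) hφ.neg hVH ?_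
      (fun x hx => mfderiv_neg_ne_zero (hd x hx)) (fun q hq v hv => ?_)
    · simpa using hVφ
    · rw [hessian_neg]
      exact neg_nonneg.2 (hess q hq v hv)
  · exact locallyConvexIn_of_hessian_nonneg g hH hV hφ hVH hVφ hd hess

end InfinitesimalToLocal

/-! ### Geodesics on one side force the sign of the Hessian -/

section LocalToInfinitesimal

variable {E : Type*} [NormedAddCommGroup E] [NormedSpace ℝ E] [FiniteDimensional ℝ E]
  {M : Type*} [TopologicalSpace M] [ChartedSpace E M] [IsManifold 𝓘(ℝ, E) 2 M]

/-- If a function vanishes at `0` to first order, is nonnegative to the right of `0`, then its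
second derivative at `0` is nonnegative. -/
lemma second_deriv_nonneg {f f' : ℝ → ℝ} {a b : ℝ} (hb : 0 < b)
    (hf : ∀ t ∈ Icc 0 b, HasDerivWithinAt f (f' t) (Icc 0 b) t)
    (hf' : HasDerivWithinAt f' a (Icc 0 b) 0) (h0 : f 0 = 0) (h0' : f' 0 = 0)
    (hnn : ∀ t ∈ Ioc 0 b, 0 ≤ f t) : 0 ≤ a := by
  by_contra! ha
  have h1 : Filter.Tendsto (slope f' 0) (𝓝[>] 0) (𝓝 a) := by
    have := hasDerivWithinAt_iff_tendsto_slope.1 hf'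
    refine this.mono_left ?_
    rw [Icc_sdiff_left, nhdsWithin_Ioc_eq_nhdsGT hb]
  have h2 : ∀ᶠ t in 𝓝[>] (0 : ℝ), f' t < 0 := by
    filter_upwards [h1.eventually (gt_mem_nhds ha), self_mem_nhdsWithin] with t ht (ht0 : 0 < t)
    rwa [slope_def_field, h0', sub_zero, sub_zero, div_lt_iff₀ ht0, zero_mul] at ht
  obtain ⟨d, hd, hdI⟩ := mem_nhdsGT_iff_exists_Ioc_subset.1
    (Filter.inter_mem h2 (Ioc_mem_nhdsGT hb))
  have hd0 : (0 : ℝ) < d := hd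
  have hdb : d ≤ b := (hdI (right_mem_Ioc.2 hd0)).2.2
  obtain ⟨t, ht, hft⟩ := exists_hasDerivAt_eq_slope f f' hd0
    (fun t ht => ((hf t ⟨ht.1, ht.2.trans hdb⟩).mono
      (Icc_subset_Icc_right hdb)).continuousWithinAt)
    (fun t ht => (hf t ⟨ht.1.le, ht.2.le.trans hdb⟩).hasDerivAt
      (Icc_mem_nhds ht.1 (ht.2.trans_le hdb)))
  have h3 : f' t < 0 := (hdI ⟨ht.1, ht.2.le⟩).1
  rw [hft, h0, sub_zero, sub_zero, div_lt_iff₀ hd0, zero_mul] at h3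
  exact absurd (hnn d ⟨hd0, hdb⟩) (not_le.2 h3)

/-- If geodesics that are tangent to `H` at `q` stay in the closed set `C`, then a function that
vanishes on `H` and is nonnegative on `C` has nonnegative Hessian at `q` on `T_q H`. -/
lemma hessian_nonneg_of_isExp [T2Space M] (g : Metric E M) {H C : Set M} {φ : M → ℝ} {q : M}
    (hφ : ContMDiffAt 𝓘(ℝ, E) 𝓘(ℝ, ℝ) 2 φ q) (hq : φ q = 0)
    (hφH : ∀ᶠ x in 𝓝 q, x ∈ H → φ x = 0) (hφC : ∀ᶠ x in 𝓝 q, x ∈ C → 0 ≤ φ x)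
    {O : Set E} (hO : O ∈ 𝓝 (0 : E))
    (hexp : ∀ v ∈ O, v ∈ tangentSet (E := E) H q → ∃ x ∈ C, IsExp g q v x) {v : E}
    (hv : v ∈ tangentSet (E := E) H q) : 0 ≤ hessian g φ q v v := by
  set c := chartAt E q with hc
  have hcA : c ∈ atlas E M := chart_mem_atlas E q
  have hcM : c ∈ IsManifold.maximalAtlas 𝓘(ℝ, E) 2 M := IsManifold.chart_mem_maximalAtlas q
  have hqc : q ∈ c.source := mem_chart_source E q
  have hcq : c.symm (c q) = q := c.left_inv hqc
  obtain ⟨ε, hε, hεO⟩ : ∃ ε > 0, ∀ t ∈ Icc (0 : ℝ) ε, t • v ∈ O := by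
    have h1 : Filter.Tendsto (fun t : ℝ => t • v) (𝓝 0) (𝓝 0) := by
      have : Continuous fun t : ℝ => t • v := by fun_prop
      simpa using this.tendsto 0
    obtain ⟨ε, hε, h2⟩ := Metric.nhds_basis_closedBall.mem_iff.1 (h1 hO)
    refine ⟨ε, hε, fun t ht => h2 ?_⟩
    rw [Metric.mem_closedBall, Real.dist_eq, sub_zero, abs_of_nonneg ht.1]
    exact ht.2
  -- The single geodesic `σ`, with initial velocity `ε • v`, serves as reference curve; the factor
  -- `ε * ε` in the Hessian is removed at the end.
  obtain ⟨-, -, σ, hσ, hσv, -⟩ := hexp (ε • v) (hεO ε ⟨hε.le, le_rfl⟩) (smul_mem_tangentSet hv ε)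
  obtain ⟨hσ0, hσc, hσd⟩ := hasVelocityWithin_iff.1 hσv
  obtain ⟨w, hw⟩ := hσ.2 c hcA
  have h01 : (0 : ℝ) ∈ Icc (0 : ℝ) 1 := left_mem_Icc.2 zero_le_one
  have hw0 : w 0 = ε • v := (uniqueDiffOn_Icc zero_lt_one 0 h01).eq_deriv _
    (hw 0 h01 (by rwa [hσ0])).1 hσd
  obtain ⟨b, hb0, hb1, hb⟩ : ∃ b, 0 < b ∧ b ≤ 1 ∧ ∀ t ∈ Icc (0 : ℝ) b, σ t ∈ c.source ∧
      (σ t ∈ C → 0 ≤ φ (σ t)) := by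
    have h1 : ∀ᶠ t in 𝓝[≥] (0 : ℝ), (σ t ∈ c.source ∧ (σ t ∈ C → 0 ≤ φ (σ t))) ∧ t ∈ Iic 1 := by
      rw [← nhdsWithin_Icc_eq_nhdsGE (zero_lt_one' ℝ)]
      have h2 : Filter.Tendsto σ (𝓝[Icc 0 1] 0) (𝓝 q) := by
        have := hσc.tendsto
        rwa [hσ0] at this
      have h3 : ∀ᶠ t in 𝓝[Icc 0 1] (0 : ℝ), t ∈ Icc (0 : ℝ) 1 := self_mem_nhdsWithin
      filter_upwards [h2.eventually (c.open_source.mem_nhds hqc), h2.eventually hφC, h3]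
        with t ht1 ht2 ht3 using ⟨⟨ht1, ht2⟩, ht3.2⟩
    obtain ⟨b, hb, hbI⟩ := mem_nhdsGE_iff_exists_Icc_subset.1 h1
    exact ⟨b, hb, (hbI (right_mem_Icc.2 (le_of_lt hb))).2, fun t ht => (hbI ht).1⟩
  have hsub : Icc (0 : ℝ) b ⊆ Icc 0 1 := Icc_subset_Icc_right hb1
  have hsol : IsChartSolution g c (c ∘ σ) w (Icc 0 b) := fun t ht => by
    obtain ⟨h1, h2⟩ := hw t (hsub ht) (hb t ht).1
    exact ⟨c.map_source (hb t ht).1, h1.mono hsub, h2.mono hsub⟩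
  -- The hypothesis only provides, for each `t`, some geodesic with initial velocity `(t * ε) • v`
  -- that ends in `C`. By uniqueness it is `σ` run at speed `t`, and its endpoint is `σ t`.
  have hC : ∀ t ∈ Icc (0 : ℝ) b, σ t ∈ C := by
    intro t ht
    have hres := hsol.rescale ht.1 ht.2
    have htO : (t * ε) • v ∈ O :=
      hεO _ ⟨mul_nonneg ht.1 hε.le, mul_le_of_le_one_left hε.le (ht.2.trans hb1)⟩
    obtain ⟨x, hxC, γ, hγ, hγv, hγ1⟩ := hexp _ htO (smul_mem_tangentSet hv _)
    obtain ⟨hγ0, -, hγd⟩ := hasVelocityWithin_iff.1 hγv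
    have heq := hres.eq_of_isGeodesicOn hcA hγ (by simp [hγ0, hσ0, hcq])
      (by simpa only [mul_zero, hw0, smul_smul] using hγd) (right_mem_Icc.2 zero_le_one)
    rw [hγ1, mul_one, Function.comp_apply, c.left_inv (hb t ht).1] at heq
    rwa [← heq]
  have hF : ContDiffAt ℝ 2 (φ ∘ c.symm) (c q) :=
    contDiffAt_comp_symm hcM (c.map_source hqc) (by rwa [hcq])
  have hdv : fderiv ℝ (φ ∘ c.symm) (c q) v = 0 :=
    fderiv_apply_eq_zero_of_mem_tangentSet hv hφ hφH
  obtain ⟨b', hb'0, hb'b, hF'⟩ : ∃ b', 0 < b' ∧ b' ≤ b ∧ ∀ t ∈ Icc (0 : ℝ) b',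
      ContDiffAt ℝ 2 (φ ∘ c.symm) ((c ∘ σ) t) := by
    have h1 : ∀ᶠ t in 𝓝[≥] (0 : ℝ), ContDiffAt ℝ 2 (φ ∘ c.symm) ((c ∘ σ) t) ∧ t ∈ Iic b := by
      rw [← nhdsWithin_Icc_eq_nhdsGE hb0]
      have h2 : Filter.Tendsto (c ∘ σ) (𝓝[Icc 0 b] 0) (𝓝 (c q)) := by
        have := (hsol 0 (left_mem_Icc.2 hb0.le)).2.1.continuousWithinAt.tendsto
        rwa [Function.comp_apply, hσ0] at this
      have h3 : ∀ᶠ t in 𝓝[Icc 0 b] (0 : ℝ), t ∈ Icc (0 : ℝ) b := self_mem_nhdsWithin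
      filter_upwards [h2.eventually (hF.eventually (by simp)), h3] with t ht1 ht2
        using ⟨ht1, ht2.2⟩
    obtain ⟨b', hb', hbI⟩ := mem_nhdsGE_iff_exists_Icc_subset.1 h1
    exact ⟨b', hb', (hbI (right_mem_Icc.2 (le_of_lt hb'))).2, fun t ht => (hbI ht).1⟩
  have hsub' : Icc (0 : ℝ) b' ⊆ Icc 0 b := Icc_subset_Icc_right hb'b
  have hsol' : IsChartSolution g c (c ∘ σ) w (Icc 0 b') := fun t ht => by
    obtain ⟨h1, h2, h3⟩ := hsol t (hsub' ht)
    exact ⟨h1, h2.mono hsub', h3.mono hsub'⟩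
  have hb'mem := left_mem_Icc.2 hb'0.le
  have hfin := second_deriv_nonneg (f := fun t => (φ ∘ c.symm) ((c ∘ σ) t))
    (f' := fun t => fderiv ℝ (φ ∘ c.symm) ((c ∘ σ) t) (w t)) hb'0
    (fun t ht => (hsol'.hasDerivWithinAt_comp ht (hF' t ht)).1)
    (hsol'.hasDerivWithinAt_comp hb'mem (hF' 0 hb'mem)).2
    (by simp [hσ0, hcq, hq]) (by simp [hσ0, hw0, hdv])
    (fun t ht => by
      have ht' := hsub' (Ioc_subset_Icc_self ht)
      have := (hb t ht').2 (hC t ht')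
      simpa [c.left_inv (hb t ht').1] using this)
  have hhess : hessian g φ q v v = chartHessian g c (φ ∘ c.symm) (c q) v := by
    simp only [hessian, chartHessian, ← hc]
    rw [show coord q v = v from coord_eq q v]
  have hscale : chartHessian g c (φ ∘ c.symm) (c q) (ε • v) =
      ε * ε * chartHessian g c (φ ∘ c.symm) (c q) v := by
    rw [chartHessian, chartHessian, christoffel_smul]
    simp only [map_smul, smul_apply, smul_eq_mul]
    ring
  rw [hw0, Function.comp_apply, hσ0, hscale] at hfin
  rw [hhess]
  exact nonneg_of_mul_nonneg_right hfin (mul_pos hε hε)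

lemma exists_bump [T2Space M] {q : M} {N : Set M} (hN : N ∈ 𝓝 q) :
    ∃ ρ : M → ℝ, ContMDiff 𝓘(ℝ, E) 𝓘(ℝ, ℝ) 2 ρ ∧ (∀ x, 0 ≤ ρ x ∧ ρ x ≤ 1) ∧ tsupport ρ ⊆ N ∧
      ∀ᶠ x in 𝓝 q, ρ x = 1 := by
  obtain ⟨f, -, hf⟩ := (SmoothBumpFunction.nhds_basis_tsupport (I := 𝓘(ℝ, E)) q).mem_iff.1 hN
  refine ⟨f, ?_, fun x => ⟨f.nonneg, f.le_one⟩, hf, f.eventuallyEq_one⟩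
  refine contMDiff_of_tsupport fun x hx => ?_
  have hx' : x ∈ (chartAt E q).source := f.tsupport_subset_chartAt_source hx
  refine ContMDiffAt.congr_of_eventuallyEq ?_ <| f.eqOn_source.eventuallyEq_of_mem <|
    (chartAt E q).open_source.mem_nhds hx'
  exact f.contDiffAt.contMDiffAt.comp _ (contMDiffAt_extChartAt' hx')

end LocalToInfinitesimal

/-! ### Regularity of a glued function -/

section Differential

variable {E : Type*} [NormedAddCommGroup E] [NormedSpace ℝ E]
  {M : Type*} [TopologicalSpace M] [ChartedSpace E M] [IsManifold 𝓘(ℝ, E) 2 M]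

/-- A function that dominates, where it is positive, a multiple of a function with nonzero
differential has nonzero differential. -/
lemma mfderiv_ne_zero_of_le {φ F : M → ℝ} {x : M} (hφ : ContMDiffAt 𝓘(ℝ, E) 𝓘(ℝ, ℝ) 2 φ x)
    (hF : ContMDiffAt 𝓘(ℝ, E) 𝓘(ℝ, ℝ) 2 F x) (hφx : φ x = 0) (hFx : F x = 0)
    (hd : mfderiv 𝓘(ℝ, E) 𝓘(ℝ, ℝ) F x ≠ 0) {δ : ℝ} (hδ : 0 < δ)
    (hle : ∀ᶠ y in 𝓝 x, 0 < F y → δ * F y ≤ φ y) : mfderiv 𝓘(ℝ, E) 𝓘(ℝ, ℝ) φ x ≠ 0 := by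
  intro h
  have hFd := fderiv_chartAt_ne_zero (hF.mdifferentiableAt two_ne_zero) hd
  have hφd := (mfderiv_eq_fderiv_chartAt (hφ.mdifferentiableAt two_ne_zero)).symm.trans h
  set c := chartAt E x with hc
  have hxc : c x ∈ c.target := c.map_source (mem_chart_source E x)
  have hcx : c.symm (c x) = x := c.left_inv (mem_chart_source E x)
  have hcd : ∀ {f : M → ℝ}, ContMDiffAt 𝓘(ℝ, E) 𝓘(ℝ, ℝ) 2 f x →
      DifferentiableAt ℝ (f ∘ c.symm) (c x) := fun hf =>
    (contDiffAt_comp_symm (IsManifold.chart_mem_maximalAtlas x) hxc (by rwa [hcx])).differentiableAt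
      two_ne_zero
  obtain ⟨m, hm⟩ : ∃ m, 0 < fderiv ℝ (F ∘ c.symm) (c x) m := by
    by_contra! h
    refine hFd (ContinuousLinearMap.ext fun m => le_antisymm (h m) ?_)
    have := h (-m)
    rw [map_neg] at this
    simpa using this
  let l : ℝ → E := fun t => c x + t • m
  have hl : HasDerivAt l m 0 := by
    have := ((hasDerivAt_id (0 : ℝ)).smul_const m).const_add (c x)
    rwa [one_smul] at this
  have hl0 : l 0 = c x := by simp [l]
  have hcomp : ∀ {f : M → ℝ}, ContMDiffAt 𝓘(ℝ, E) 𝓘(ℝ, ℝ) 2 f x →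
      HasDerivAt (fun t => (f ∘ c.symm) (l t)) (fderiv ℝ (f ∘ c.symm) (c x) m) 0 := fun hf =>
    HasFDerivAt.comp_hasDerivAt (0 : ℝ) (by rw [hl0]; exact (hcd hf).hasFDerivAt) hl
  have h1 := eventually_pos_of_hasDerivAt (hcomp hF) (by simp [hl0, hcx, hFx]) hm
  -- If the differential of `φ` vanished, then along `l` the function `δ * F - φ` would have
  -- positive derivative and so become positive where `F > 0`, against `hle`.
  have h2 := eventually_pos_of_hasDerivAt (((hcomp hF).const_mul δ).sub (hcomp hφ))
    (by simp [hl0, hcx, hFx, hφx]) (by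
      have : fderiv ℝ (φ ∘ c.symm) (c x) m = 0 := congrArg (fun L : E →L[ℝ] ℝ => L m) hφd
      rw [this, sub_zero]
      positivity)
  have h3 : Filter.Tendsto (fun t => c.symm (l t)) (𝓝[>] 0) (𝓝 x) := by
    have : ContinuousAt (fun t => c.symm (l t)) 0 :=
      ContinuousAt.comp (f := l) (by rw [hl0]; exact c.continuousAt_symm hxc) hl.continuousAt
    have := this.tendsto.mono_left (nhdsWithin_le_nhds (s := Ioi 0))
    simpa only [hl0, hcx] using this
  obtain ⟨t, ht1, ht2, ht3⟩ := (h1.and (h2.and (h3.eventually hle))).exists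
  have ht4 := ht3 ht1
  simp only [Pi.sub_apply, Function.comp_apply] at ht2
  linarith

end Differential

/-! ### A countable partition of unity -/

section Partition

/-- The functions `ρᵢ ∏_{j < i} (1 - ρⱼ)`, whose sum is one wherever some `ρⱼ` is one. -/
def partitionFun {M : Type*} (ρ : ℕ → M → ℝ) (i : ℕ) (x : M) : ℝ :=
  ρ i x * ∏ j ∈ Finset.range i, (1 - ρ j x)

variable {M : Type*} {ρ : ℕ → M → ℝ}

lemma sum_partitionFun (ρ : ℕ → M → ℝ) (n : ℕ) (x : M) :
    ∑ i ∈ Finset.range n, partitionFun ρ i x = 1 - ∏ j ∈ Finset.range n, (1 - ρ j x) := by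
  induction n with
  | zero => simp
  | succ k ih =>
    rw [Finset.sum_range_succ, Finset.prod_range_succ, ih, partitionFun]
    ring

lemma partitionFun_nonneg (hρ : ∀ i x, 0 ≤ ρ i x ∧ ρ i x ≤ 1) (i : ℕ) (x : M) :
    0 ≤ partitionFun ρ i x :=
  mul_nonneg (hρ i x).1 (Finset.prod_nonneg fun j _ => sub_nonneg.2 (hρ j x).2)

lemma partitionFun_eq_zero {i j : ℕ} {x : M} (hx : ρ j x = 1) (hij : j < i) :
    partitionFun ρ i x = 0 := by
  rw [partitionFun, Finset.prod_eq_zero (Finset.mem_range.2 hij) (by rw [hx, sub_self]), mul_zero]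

lemma sum_partitionFun_eq_one {j : ℕ} {x : M} (hx : ρ j x = 1) :
    ∑ i ∈ Finset.range (j + 1), partitionFun ρ i x = 1 := by
  rw [sum_partitionFun, Finset.prod_eq_zero (Finset.mem_range.2 j.lt_succ_self)
    (by rw [hx, sub_self]), sub_zero]

/-- A factor `1 - ρ j x = 0` kills every later term. The length `j + 1` is the same on the whole set
where `ρ j` is one, so no local finiteness of the cover is needed. -/
lemma tsum_partitionFun_mul {j : ℕ} {x : M} (hx : ρ j x = 1) (F : ℕ → M → ℝ) :
    ∑' i, partitionFun ρ i x * F i x =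
      ∑ i ∈ Finset.range (j + 1), partitionFun ρ i x * F i x := by
  refine tsum_eq_sum fun i hi => ?_
  rw [partitionFun_eq_zero hx (by simpa using hi), zero_mul]

end Partition

/-! ### Local convexity implies infinitesimal convexity: gluing defining functions -/

section LocalToInfinitesimal

variable {E : Type*} [NormedAddCommGroup E] [NormedSpace ℝ E] [FiniteDimensional ℝ E]
  {M : Type*} [TopologicalSpace M] [ChartedSpace E M] [IsManifold 𝓘(ℝ, E) 2 M]

theorem LocallyConvexIn.infinitesimallyConvexIn [T2Space M] [SecondCountableTopology M]
    {g : Metric E M} {H U : Set M} (hH : IsHypersurface E H) (hU : U.Nonempty)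
    (h : LocallyConvexIn g H U) : InfinitesimallyConvexIn g H U := by
  obtain ⟨V, A, B, hV, hVH, ⟨hA, hB, hAB, hcov, hclA, hclB, -⟩, hexp⟩ := h
  rw [hVH] at hclA hclB
  have hUV : ∀ x ∈ U, x ∈ V := fun x hx => (hVH.symm.subset hx).1
  have hUH : ∀ x ∈ U, x ∈ H := fun x hx => (hVH.symm.subset hx).2
  have hloc : ∀ q : M, ∃ (N : Set M) (F ρ : M → ℝ), q ∈ U → IsOpen N ∧ N ⊆ V ∧
      ContMDiffOn 𝓘(ℝ, E) 𝓘(ℝ, ℝ) 2 F N ∧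
      (∀ x ∈ N, (0 < F x ↔ x ∈ A) ∧ (F x < 0 ↔ x ∈ B) ∧ (F x = 0 ↔ x ∈ H) ∧
        mfderiv 𝓘(ℝ, E) 𝓘(ℝ, ℝ) F x ≠ 0) ∧
      ContMDiff 𝓘(ℝ, E) 𝓘(ℝ, ℝ) 2 ρ ∧ (∀ x, 0 ≤ ρ x ∧ ρ x ≤ 1) ∧ tsupport ρ ⊆ N ∧
      ∀ᶠ x in 𝓝 q, ρ x = 1 := by
    intro q
    by_cases hq : q ∈ U
    · obtain ⟨N, F, h1, h2, h3, h4, h5, -, -⟩ := exists_side_nhds hH (hUH q hq) hV (hUV q hq) hA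
        hB hAB hcov (hclA hq) (hclB hq)
      obtain ⟨ρ, h6, h7, h8, h9⟩ := exists_bump (E := E) (h1.mem_nhds h2)
      exact ⟨N, F, ρ, fun _ => ⟨h1, h3, h4, h5, h6, h7, h8, h9⟩⟩
    · exact ⟨∅, 0, 0, fun h => absurd h hq⟩
  choose N F ρ hNF using hloc
  -- Second countability reduces the cover by the sets where a bump is one to a countable one; since
  -- `U` is nonempty, it can be listed as a sequence.
  obtain ⟨t, htU, htc, htcov⟩ := TopologicalSpace.countable_cover_nhdsWithin
    (f := fun q => interior {x | ρ q x = 1}) (s := U) fun q hq =>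
      mem_nhdsWithin_of_mem_nhds (interior_mem_nhds.2 (hNF q hq).2.2.2.2.2.2.2)
  have htne : t.Nonempty := by
    obtain ⟨p, hp⟩ := hU
    obtain ⟨q, hq, -⟩ := mem_iUnion₂.1 (htcov hp)
    exact ⟨q, hq⟩
  obtain ⟨s, rfl⟩ := htc.exists_eq_range htne
  have hs : ∀ i, s i ∈ U := fun i => htU (mem_range_self i)
  set G : ℕ → Set M := fun i => interior {x | ρ (s i) x = 1} with hG
  have hG1 : ∀ i, ∀ x ∈ G i, ρ (s i) x = 1 := fun i x hx => (interior_subset hx : x ∈ {x | ρ (s i) x = 1})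
  have hρ01 : ∀ i x, 0 ≤ ρ (s i) x ∧ ρ (s i) x ≤ 1 := fun i => (hNF _ (hs i)).2.2.2.2.2.1
  have hts : ∀ i, tsupport (ρ (s i)) ⊆ N (s i) := fun i => (hNF _ (hs i)).2.2.2.2.2.2.1
  have hsgn := fun i => (hNF _ (hs i)).2.2.2.1
  have hGV : ∀ i, G i ⊆ V := fun i x hx => (hNF _ (hs i)).2.1
    (hts i (subset_tsupport _ (by rw [Function.mem_support, hG1 i x hx]; exact one_ne_zero)))
  set χ := partitionFun (fun i => ρ (s i)) with hχ
  have hχ0 : ∀ i x, 0 ≤ χ i x := partitionFun_nonneg hρ01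
  have hχN : ∀ i x, χ i x ≠ 0 → x ∈ N (s i) := fun i x hx =>
    hts i (subset_tsupport _ (left_ne_zero_of_mul hx))
  have hχs : ∀ i, ContMDiff 𝓘(ℝ, E) 𝓘(ℝ, ℝ) 2 (χ i) := fun i =>
    (hNF _ (hs i)).2.2.2.2.1.mul
      (contMDiff_finsetProd fun j _ => contMDiff_const.sub (hNF _ (hs j)).2.2.2.2.1)
  -- `F (s i)` is controlled only on `N (s i)`, but off the support of the bump, which lies in `N (s
  -- i)`, the product vanishes identically nearby.
  have hterm : ∀ i x, ContMDiffAt 𝓘(ℝ, E) 𝓘(ℝ, ℝ) 2 (fun y => χ i y * F (s i) y) x := by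
    intro i x
    by_cases hx : x ∈ N (s i)
    · exact (hχs i).contMDiffAt.mul
        ((hNF _ (hs i)).2.2.1.contMDiffAt ((hNF _ (hs i)).1.mem_nhds hx))
    · have : (fun y => χ i y * F (s i) y) =ᶠ[𝓝 x] fun _ => 0 := by
        have h1 : ∀ᶠ y in 𝓝 x, ρ (s i) y = 0 :=
          notMem_tsupport_iff_eventuallyEq.1 fun h => hx (hts i h)
        filter_upwards [h1] with y hy
        simp [hχ, partitionFun, hy]
      exact contMDiffAt_const.congr_of_eventuallyEq this
  -- Only the values on the union of the `G j` matter: on `G j` the series is a finite sum of fixed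
  -- length. All `F (s i)` have the same sign on each side, so the weights cannot create
  -- cancellation.
  let φ : M → ℝ := fun x => ∑' i, χ i x * F (s i) x
  have hφ : ∀ j, ∀ x ∈ G j, φ x = ∑ i ∈ Finset.range (j + 1), χ i x * F (s i) x := fun j x hx =>
    tsum_partitionFun_mul (ρ := fun i => ρ (s i)) (hG1 j x hx) (fun i => F (s i))
  have hφs : ∀ j, ∀ x ∈ G j, ContMDiffAt 𝓘(ℝ, E) 𝓘(ℝ, ℝ) 2 φ x := by
    intro j x hx
    have h1 : φ =ᶠ[𝓝 x] fun y => ∑ i ∈ Finset.range (j + 1), χ i y * F (s i) y := by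
      filter_upwards [isOpen_interior.mem_nhds hx] with y hy using hφ j y hy
    refine ContMDiffAt.congr_of_eventuallyEq ?_ h1
    exact contMDiffAt_finsetSum fun i _ => hterm i x
  have hex : ∀ j, ∀ x ∈ G j, ∃ i ∈ Finset.range (j + 1), 0 < χ i x := by
    intro j x hx
    by_contra! hc
    have h1 : ∑ i ∈ Finset.range (j + 1), χ i x = 1 :=
      sum_partitionFun_eq_one (ρ := fun i => ρ (s i)) (hG1 j x hx)
    have := Finset.sum_nonpos hc
    linarith
  have hposA : ∀ j, ∀ x ∈ G j, x ∈ A → ∀ i, 0 ≤ χ i x * F (s i) x := by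
    intro j x hx hxA i
    by_cases h0 : χ i x = 0
    · simp [h0]
    · exact mul_nonneg (hχ0 i x) ((hsgn i x (hχN i x h0)).1.2 hxA).le
  have hφA : ∀ j, ∀ x ∈ G j, x ∈ A → 0 < φ x := by
    intro j x hx hxA
    rw [hφ j x hx]
    obtain ⟨i, hi, hi0⟩ := hex j x hx
    exact Finset.sum_pos' (fun i _ => hposA j x hx hxA i)
      ⟨i, hi, mul_pos hi0 ((hsgn i x (hχN i x hi0.ne')).1.2 hxA)⟩
  have hφB : ∀ j, ∀ x ∈ G j, x ∈ B → φ x < 0 := by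
    intro j x hx hxB
    rw [hφ j x hx]
    obtain ⟨i, hi, hi0⟩ := hex j x hx
    refine Finset.sum_neg' (fun i _ => ?_)
      ⟨i, hi, mul_neg_of_pos_of_neg hi0 ((hsgn i x (hχN i x hi0.ne')).2.1.2 hxB)⟩
    by_cases h0 : χ i x = 0
    · simp [h0]
    · exact mul_nonpos_of_nonneg_of_nonpos (hχ0 i x) ((hsgn i x (hχN i x h0)).2.1.2 hxB).le
  have hφH : ∀ j, ∀ x ∈ G j, x ∈ H → φ x = 0 := by
    intro j x hx hxH
    rw [hφ j x hx]
    refine Finset.sum_eq_zero fun i _ => ?_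
    by_cases h0 : χ i x = 0
    · simp [h0]
    · rw [(hsgn i x (hχN i x h0)).2.2.1.2 hxH, mul_zero]
  have hUG : ∀ x ∈ U, ∃ j, x ∈ G j := fun x hx => by
    simpa [hG] using htcov hx
  have hGo : IsOpen (⋃ j, G j) := isOpen_iUnion fun j => isOpen_interior
  refine ⟨⋃ j, G j, φ, hGo, fun x hx => ?_, ?_, ?_, fun x hx => ?_, Or.inr fun q hq v hv => ?_⟩
  · obtain ⟨j, hj⟩ := mem_iUnion.1 hx
    exact (hφs j x hj).contMDiffWithinAt
  · ext x
    refine ⟨fun ⟨hx, hxH⟩ => ?_, fun hx => ⟨mem_iUnion.2 (hUG x hx), hUH x hx⟩⟩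
    obtain ⟨j, hj⟩ := mem_iUnion.1 hx
    exact hVH.subset ⟨hGV j hj, hxH⟩
  · ext x
    constructor
    · rintro ⟨hx, hx0⟩
      obtain ⟨j, hj⟩ := mem_iUnion.1 hx
      by_contra hxU
      have hxAB : x ∈ A ∪ B := by
        rw [hcov]
        exact ⟨hGV j hj, fun hxH => hxU (hVH.subset ⟨hGV j hj, hxH⟩)⟩
      rcases hxAB with hxA | hxB
      · exact (hφA j x hj hxA).ne' hx0
      · exact (hφB j x hj hxB).ne hx0
    · intro hx
      obtain ⟨j, hj⟩ := hUG x hx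
      exact ⟨mem_iUnion.2 ⟨j, hj⟩, hφH j x hj (hUH x hx)⟩
  -- Some weight `χ i` is positive at `x`, hence above half its value nearby. On the side `A` all
  -- terms are nonnegative, so `φ` dominates `χ i x / 2` times `F (s i)`.
  · obtain ⟨j, hj⟩ := hUG x hx
    obtain ⟨i, hi, hi0⟩ := hex j x hj
    have hxN := hχN i x hi0.ne'
    have hNo := (hNF _ (hs i)).1.mem_nhds hxN
    refine mfderiv_ne_zero_of_le (hφs j x hj) ((hNF _ (hs i)).2.2.1.contMDiffAt hNo)
      (hφH j x hj (hUH x hx)) ((hsgn i x hxN).2.2.1.2 (hUH x hx)) (hsgn i x hxN).2.2.2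
      (half_pos hi0) ?_
    filter_upwards [hNo, isOpen_interior.mem_nhds hj,
      (hχs i).continuous.continuousAt.eventually (lt_mem_nhds (half_lt_self hi0))]
      with y hyN hyG hyχ hyF
    have hyA := (hsgn i y hyN).1.1 hyF
    rw [hφ j y hyG]
    calc χ i x / 2 * F (s i) y ≤ χ i y * F (s i) y := mul_le_mul_of_nonneg_right hyχ.le hyF.le
      _ ≤ _ := Finset.single_le_sum (f := fun i => χ i y * F (s i) y)
        (fun i _ => hposA j y hyG hyA i) hi
  · obtain ⟨j, hj⟩ := hUG q hq
    obtain ⟨O, hO, hOexp⟩ := hexp q hq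
    have hGj := isOpen_interior.mem_nhds hj
    refine hessian_nonneg_of_isExp g (hφs j q hj) (hφH j q hj (hUH q hq)) ?_ ?_ hO hOexp hv
    · filter_upwards [hGj] with x hx using hφH j x hx
    · filter_upwards [hGj] with x hx hxA
      by_cases hxH : x ∈ H
      · exact (hφH j x hx hxH).ge
      · have hxAB : x ∈ A ∪ B := by rw [hcov]; exact ⟨hGV j hx, hxH⟩
        rcases hxAB with h | h
        · exact (hφA j x hx h).le
        -- `B` is open and disjoint from `A`, so it does not meet the closure of `A`.
        · exact absurd h (disjoint_left.1 (hAB.closure_left hB) hxA)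

end LocalToInfinitesimal

end SemiRiem

end

theorem theorem3p1 {E : Type*} [NormedAddCommGroup E] [NormedSpace ℝ E] [FiniteDimensional ℝ E]
    {M : Type*} [TopologicalSpace M] [ChartedSpace E M] [IsManifold 𝓘(ℝ, E) 2 M]
    [T2Space M] [SecondCountableTopology M]
    (g : SemiRiem.Metric E M) (H : Set M) (hH : SemiRiem.IsHypersurface E H)
    (U : Set M) (hU : ∃ W : Set M, IsOpen W ∧ U = W ∩ H) (p : M) (hp : p ∈ U) :
    SemiRiem.InfinitesimallyConvexIn g H U ↔ SemiRiem.LocallyConvexIn g H U :=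
  ⟨fun h => h.locallyConvexIn hH, fun h => h.infinitesimallyConvexIn hH ⟨p, hp⟩⟩
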